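/- All Banach spaces are real, and $X'$ denotes the dual of $X$. A sequence $(x_i)$ in a Banach space \emph{dominates} a sequence $(y_i)$ in a possibly different Banach space if there is a constant $C$ with $\|\sum a_i y_i\|\le C\|\sum a_i x_i\|$ for all finitely non-zero real sequences $(a_i)$; two sequences are \emph{equivalent} if each dominates the other. A basis is \emph{subsymmetric} if it is unconditional and equivalent to each of its subsequences. A Banach space $X$ has \emph{Property (w)} if every bounded linear operator from $X$ into $X'$ is weakly compact. For a normalized basis $(e_i)_{i\ge 1}$ of a Banach space $E$, with biorthogonal functionals $(e_i')$, let $J(e_i)$ be the completion of the space of finitely non-zero real sequences $(a_i)$, written as formal sums $\sum a_i u_i$, under the norm \[ \Bigl\|\sum a_iu_i\Bigr\| = \sup\Bigl\{\Bigl\|\sum_{i=1}^k\Bigl(\sum_{j=p(i)}^{p(i+1)-1}a_j\Bigr)e_{p(i)}\Bigr\| : k\in\mathbb N,\ 1=p(1)<p(2)<\dots<p(k+1)\Bigr\}. \] \textbf{Proposition.} Let $(e_i)$ be a subsymmetric normalized basis of a reflexive Banach space $E$, and let $1<p<\infty$. Assume that (i) $E$ satisfies an upper $p$-estimate, that is,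 there is a constant $M$ such that $\|\sum_{i=1}^n x_i\|\le M\bigl(\sum_{i=1}^n\|x_i\|^p\bigr)^{1/p}$ for all $n$ and all $x_1,\dots,x_n\in E$ whose supports with respect to $(e_i)$ are pairwise disjoint; (ii) $(e_i')$ does not dominate $(e_i)$; and (iii) the unit vector basis of $\ell^p$ does not dominate $(e_i')$. Then both $J(e_i)$ and $J(e_i)'$ have Property (w), but neither has a weakly sequentially complete dual; that is, neither $J(e_i)'$ nor $J(e_i)''$ is weakly sequentially complete. -/

import Mathlib

open Filter Topology
open scoped ENNReal

noncomputable section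

/-! ### Notions for sequences in Banach spaces -/

/-- The sequence `x` dominates the sequence `y`: there is a constant `C` with
`‖∑ aᵢ yᵢ‖ ≤ C ‖∑ aᵢ xᵢ‖` for all finitely non-zero real sequences `a`. -/
def Dominates {X Y : Type*} [NormedAddCommGroup X] [NormedSpace ℝ X]
    [NormedAddCommGroup Y] [NormedSpace ℝ Y] (x : ℕ → X) (y : ℕ → Y) : Prop :=
  ∃ C : ℝ, ∀ a : ℕ →₀ ℝ,
    ‖∑ i ∈ a.support, a i • y i‖ ≤ C * ‖∑ i ∈ a.support, a i • x i‖

/-- Two sequences are equivalent if each dominates the other. -/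
def SeqEquivalent {X Y : Type*} [NormedAddCommGroup X] [NormedSpace ℝ X]
    [NormedAddCommGroup Y] [NormedSpace ℝ Y] (x : ℕ → X) (y : ℕ → Y) : Prop :=
  Dominates x y ∧ Dominates y x

/-- A basis is subsymmetric if it is unconditional (every expansion converges unconditionally)
and it is equivalent to each of its subsequences. -/
def IsSubsymmetric {E : Type*} [NormedAddCommGroup E] [NormedSpace ℝ E]
    (b : SchauderBasis ℝ E) : Prop :=
  (∀ x : E, HasSum (fun i => b.coord i x • b i) x) ∧
    ∀ n : ℕ → ℕ, StrictMono n → SeqEquivalent (fun i => b (n i)) (fun i => b i)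

/-- The space `E`, with the lattice structure given by the coordinates with respect to the basis
`b`, satisfies an upper `p`-estimate: `‖x₁ + ⋯ + xₙ‖ ≤ M (‖x₁‖ᵖ + ⋯ + ‖xₙ‖ᵖ) ^ (1 / p)` for
pairwise disjoint `x₁, …, xₙ`. -/
def UpperEstimate {E : Type*} [NormedAddCommGroup E] [NormedSpace ℝ E]
    (b : SchauderBasis ℝ E) (p : ℝ) : Prop :=
  ∃ M : ℝ, ∀ (n : ℕ) (x : Fin n → E),
    (∀ i j, i ≠ j → ∀ k, b.coord k (x i) = 0 ∨ b.coord k (x j) = 0) →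
      ‖∑ i, x i‖ ≤ M * (∑ i, ‖x i‖ ^ p) ^ (1 / p)

/-- The unit vector basis of `ℓᵖ`. -/
def lpUnitVector (p : ℝ≥0∞) (i : ℕ) : lp (fun _ : ℕ => ℝ) p :=
  lp.single p i (1 : ℝ)

/-! ### Notions for Banach spaces -/

/-- `E` is reflexive: the canonical map into the bidual is onto. -/
def IsReflexiveSpace (E : Type*) [NormedAddCommGroup E] [NormedSpace ℝ E] : Prop :=
  Function.Surjective (NormedSpace.inclusionInDoubleDual ℝ E)

/-- A bounded operator is weakly compact if the image of the closed unit ball is relatively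
compact in the weak topology. -/
def IsWeaklyCompactOperator {X Y : Type*} [NormedAddCommGroup X] [NormedSpace ℝ X]
    [NormedAddCommGroup Y] [NormedSpace ℝ Y] (T : X →L[ℝ] Y) : Prop :=
  IsCompact (closure ((fun x : X => toWeakSpace ℝ Y (T x)) '' Metric.closedBall (0 : X) 1))

/-- Property (w): every bounded operator from `X` into its dual is weakly compact. -/
def PropertyW (X : Type*) [NormedAddCommGroup X] [NormedSpace ℝ X] : Prop :=
  ∀ T : X →L[ℝ] StrongDual ℝ X, IsWeaklyCompactOperator T

/-- `X` is weakly sequentially complete: every weakly Cauchy sequence converges weakly. -/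
def WeaklySequentiallyComplete (X : Type*) [NormedAddCommGroup X] [NormedSpace ℝ X] : Prop :=
  ∀ x : ℕ → X, (∀ f : StrongDual ℝ X, CauchySeq fun n => f (x n)) →
    ∃ x₀ : X, ∀ f : StrongDual ℝ X, Tendsto (fun n => f (x n)) atTop (𝓝 (f x₀))

/-! ### The James type space of a sequence -/

section James

variable {E : Type*} [NormedAddCommGroup E] [NormedSpace ℝ E]

/-- The representative of `∑ aⱼ uⱼ` in `E` given by the first `k` of the successive intervals
`[p 0, p 1), [p 1, p 2), …`. -/
def jamesRepr (e : ℕ → E) (a : ℕ →₀ ℝ) (k : ℕ) (p : ℕ → ℕ) : E :=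
  ∑ i ∈ Finset.range k, (∑ j ∈ Finset.Ico (p i) (p (i + 1)), a j) • e (p i)

/-- The norms of all representatives of `∑ aⱼ uⱼ`. Indices start at `0`, so the intervals
start at the index `p 0 = 0`. -/
def jamesReprNorms (e : ℕ → E) (a : ℕ →₀ ℝ) : Set ℝ :=
  {r | ∃ (k : ℕ) (p : ℕ → ℕ), StrictMono p ∧ p 0 = 0 ∧ r = ‖jamesRepr e a k p‖}

/-- The James norm of `∑ aⱼ uⱼ`: the supremum of the norms of its representatives. -/
def jamesNorm (e : ℕ → E) (a : ℕ →₀ ℝ) : ℝ :=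
  sSup (jamesReprNorms e a)

theorem jamesReprNorms_nonempty (e : ℕ → E) (a : ℕ →₀ ℝ) : (jamesReprNorms e a).Nonempty :=
  ⟨_, 0, id, strictMono_id, rfl, rfl⟩

theorem jamesReprNorms_bddAbove (e : ℕ → E) (a : ℕ →₀ ℝ) : BddAbove (jamesReprNorms e a) := by
  set g : ℕ → ℝ := fun j => |a j| * ∑ m ∈ Finset.range (j + 1), ‖e m‖ with hg
  have hg0 : ∀ j, 0 ≤ g j := fun j =>
    mul_nonneg (abs_nonneg _) (Finset.sum_nonneg fun _ _ => norm_nonneg _)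
  refine ⟨∑ j ∈ a.support, g j, ?_⟩
  rintro r ⟨k, p, hp, hp0, rfl⟩
  have h1 : ‖jamesRepr e a k p‖ ≤
      ∑ i ∈ Finset.range k, ∑ j ∈ Finset.Ico (p i) (p (i + 1)), g j := by
    refine (norm_sum_le _ _).trans (Finset.sum_le_sum fun i _ => ?_)
    rw [norm_smul, Real.norm_eq_abs]
    refine (mul_le_mul_of_nonneg_right (Finset.abs_sum_le_sum_abs _ _) (norm_nonneg _)).trans ?_
    rw [Finset.sum_mul]
    refine Finset.sum_le_sum fun j hj => mul_le_mul_of_nonneg_left ?_ (abs_nonneg _)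
    refine Finset.single_le_sum (f := fun m => ‖e m‖) (fun _ _ => norm_nonneg _) ?_
    have := (Finset.mem_Ico.1 hj).1
    exact Finset.mem_range.2 (by omega)
  have h2 : ∀ n, ∑ i ∈ Finset.range n, ∑ j ∈ Finset.Ico (p i) (p (i + 1)), g j =
      ∑ j ∈ Finset.Ico (p 0) (p n), g j := by
    intro n
    induction n with
    | zero => simp
    | succ n ih =>
      rw [Finset.sum_range_succ, ih]
      exact Finset.sum_Ico_consecutive g (hp.monotone (Nat.zero_le n)) (hp n.lt_succ_self).le
  rw [h2 k] at h1
  refine h1.trans ?_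
  rw [← Finset.sum_filter_add_sum_filter_not (Finset.Ico (p 0) (p k)) (fun j => j ∈ a.support)]
  have h3 : ∑ j ∈ Finset.Ico (p 0) (p k) with j ∉ a.support, g j = 0 := by
    refine Finset.sum_eq_zero fun j hj => ?_
    have : a j = 0 := by simpa using (Finset.mem_filter.1 hj).2
    simp [hg, this]
  rw [h3, add_zero]
  exact Finset.sum_le_sum_of_subset_of_nonneg
    (fun j hj => (Finset.mem_filter.1 hj).2) (fun j _ _ => hg0 j)

theorem norm_jamesRepr_le (e : ℕ → E) (a : ℕ →₀ ℝ) (k : ℕ) {p : ℕ → ℕ} (hp : StrictMono p)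
    (hp0 : p 0 = 0) : ‖jamesRepr e a k p‖ ≤ jamesNorm e a :=
  le_csSup (jamesReprNorms_bddAbove e a) ⟨k, p, hp, hp0, rfl⟩

theorem jamesNorm_le (e : ℕ → E) (a : ℕ →₀ ℝ) {M : ℝ}
    (h : ∀ (k : ℕ) (p : ℕ → ℕ), StrictMono p → p 0 = 0 → ‖jamesRepr e a k p‖ ≤ M) :
    jamesNorm e a ≤ M := by
  refine csSup_le (jamesReprNorms_nonempty e a) ?_
  rintro r ⟨k, p, hp, hp0, rfl⟩
  exact h k p hp hp0

theorem jamesNorm_nonneg (e : ℕ → E) (a : ℕ →₀ ℝ) : 0 ≤ jamesNorm e a :=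
  (norm_nonneg _).trans (norm_jamesRepr_le e a 0 strictMono_id rfl)

theorem jamesRepr_add (e : ℕ → E) (a a' : ℕ →₀ ℝ) (k : ℕ) (p : ℕ → ℕ) :
    jamesRepr e (a + a') k p = jamesRepr e a k p + jamesRepr e a' k p := by
  simp [jamesRepr, Finset.sum_add_distrib, add_smul]

theorem jamesRepr_smul (e : ℕ → E) (c : ℝ) (a : ℕ →₀ ℝ) (k : ℕ) (p : ℕ → ℕ) :
    jamesRepr e (c • a) k p = c • jamesRepr e a k p := by
  simp [jamesRepr, Finset.smul_sum, ← Finset.mul_sum, mul_smul]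

theorem jamesNorm_add_le (e : ℕ → E) (a a' : ℕ →₀ ℝ) :
    jamesNorm e (a + a') ≤ jamesNorm e a + jamesNorm e a' :=
  jamesNorm_le e _ fun k p hp hp0 => by
    rw [jamesRepr_add]
    exact (norm_add_le _ _).trans
      (add_le_add (norm_jamesRepr_le e a k hp hp0) (norm_jamesRepr_le e a' k hp hp0))

theorem jamesNorm_smul_le (e : ℕ → E) (c : ℝ) (a : ℕ →₀ ℝ) :
    jamesNorm e (c • a) ≤ ‖c‖ * jamesNorm e a :=
  jamesNorm_le e _ fun k p hp hp0 => by
    rw [jamesRepr_smul, norm_smul]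
    exact mul_le_mul_of_nonneg_left (norm_jamesRepr_le e a k hp hp0) (norm_nonneg _)

theorem jamesNorm_smul (e : ℕ → E) (c : ℝ) (a : ℕ →₀ ℝ) :
    jamesNorm e (c • a) = ‖c‖ * jamesNorm e a := by
  refine le_antisymm (jamesNorm_smul_le e c a) ?_
  rcases eq_or_ne c 0 with rfl | hc
  · simpa using jamesNorm_nonneg e _
  · have h := jamesNorm_smul_le e c⁻¹ (c • a)
    rw [smul_smul, inv_mul_cancel₀ hc, one_smul, norm_inv] at h
    have hc' : 0 < ‖c‖ := norm_pos_iff.2 hc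
    calc ‖c‖ * jamesNorm e a ≤ ‖c‖ * (‖c‖⁻¹ * jamesNorm e (c • a)) :=
          mul_le_mul_of_nonneg_left h hc'.le
      _ = jamesNorm e (c • a) := by rw [← mul_assoc, mul_inv_cancel₀ hc'.ne', one_mul]

/-- The linear span of the sequence `(uᵢ)`: the finitely non-zero real sequences `(aᵢ)`, which
stand for `∑ aᵢ uᵢ`, with the James norm built from the sequence `e`. -/
def PreJames (_e : ℕ → E) : Type := ℕ →₀ ℝ

instance (e : ℕ → E) : AddCommGroup (PreJames e) := inferInstanceAs (AddCommGroup (ℕ →₀ ℝ))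

instance (e : ℕ → E) : Module ℝ (PreJames e) := inferInstanceAs (Module ℝ (ℕ →₀ ℝ))

instance (e : ℕ → E) : Norm (PreJames e) := ⟨fun a => jamesNorm e a⟩

theorem preJames_core (e : ℕ → E) : SeminormedSpace.Core ℝ (PreJames e) where
  norm_nonneg a := jamesNorm_nonneg e a
  norm_smul c a := jamesNorm_smul e c a
  norm_triangle a a' := jamesNorm_add_le e a a'

/-- If `e` is a basis this seminorm is a norm (the intervals of length one give
`‖∑ aᵢ eᵢ‖ ≤ ‖∑ aᵢ uᵢ‖`). -/
instance (e : ℕ → E) : SeminormedAddCommGroup (PreJames e) :=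
  SeminormedAddCommGroup.ofCore (preJames_core e)

instance (e : ℕ → E) : NormedSpace ℝ (PreJames e) where
  norm_smul_le c a := (jamesNorm_smul e c a).le

/-- The James type space `J(eᵢ)`: the completion of the linear span of `(uᵢ)`. -/
abbrev JamesSpace (e : ℕ → E) : Type := UniformSpace.Completion (PreJames e)

end James

end

section WeakLimits

variable {X Y : Type*} [NormedAddCommGroup X] [NormedSpace ℝ X]
  [NormedAddCommGroup Y] [NormedSpace ℝ Y]

/-- A sequence is weakly Cauchy if every functional maps it to a Cauchy sequence. -/
def WeaklyCauchy (x : ℕ → X) : Prop := ∀ f : StrongDual ℝ X, CauchySeq fun n => f (x n)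

/-- Every element of the bidual is the sum of an element of `X` and a multiple of the weak* limit
of the sequence `x`. -/
def BidualSpannedBy (x : ℕ → X) : Prop :=
  ∀ φ : StrongDual ℝ (StrongDual ℝ X), ∃ (z : X) (c : ℝ), ∀ f : StrongDual ℝ X,
    Tendsto (fun n => f z + c * f (x n)) atTop (𝓝 (φ f))

theorem WeaklyCauchy.exists_weakStar_limit {x : ℕ → X} (hx : WeaklyCauchy x) :
    ∃ θ : StrongDual ℝ (StrongDual ℝ X), ∀ f : StrongDual ℝ X,
      Tendsto (fun n => f (x n)) atTop (𝓝 (θ f)) := by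
  choose g hg using fun f => cauchySeq_tendsto_of_complete (hx f)
  refine ⟨continuousLinearMapOfTendsto (l := atTop)
    (fun n => NormedSpace.inclusionInDoubleDual ℝ X (x n)) (f := g)
    (tendsto_pi_nhds.2 fun f => ?_), fun f => ?_⟩
  · simpa using hg f
  · exact hg f

/-- If `x` spans the bidual over `X`, an operator mapping `x` to a weakly convergent sequence is
weakly compact. -/
theorem BidualSpannedBy.isWeaklyCompactOperator {x : ℕ → X} (hx : BidualSpannedBy x)
    (T : X →L[ℝ] Y) {y : Y}
    (hy : ∀ g : StrongDual ℝ Y, Tendsto (fun n => g (T (x n))) atTop (𝓝 (g y))) :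
    IsWeaklyCompactOperator T := by
  refine NormedSpace.isCompact_closure_of_isBounded ℝ Y _ ?_ ?_
  · have h : Bornology.IsBounded (T '' Metric.closedBall (0 : X) 1) :=
      (T.lipschitz.isBounded_image Metric.isBounded_closedBall)
    refine h.subset ?_
    rintro z ⟨w, hw, hz⟩
    exact ⟨w, hw, (toWeakSpace ℝ Y).injective hz⟩
  · let A : StrongDual ℝ Y →L[ℝ] StrongDual ℝ X := ContinuousLinearMap.compL ℝ X Y ℝ |>.flip T
    let G : WeakDual ℝ (StrongDual ℝ X) → WeakDual ℝ (StrongDual ℝ Y) := fun φ =>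
      StrongDual.toWeakDual ((WeakDual.toStrongDual φ).comp A)
    have hG : Continuous G := by
      refine WeakDual.continuous_of_continuous_eval fun g => ?_
      exact WeakDual.eval_continuous (A g)
    have hK : IsCompact (G '' (WeakDual.toStrongDual ⁻¹' Metric.closedBall 0 1)) :=
      (WeakDual.isCompact_closedBall (𝕜 := ℝ) (E := StrongDual ℝ X) 0 1).image hG
    refine (closure_minimal (t := G '' (WeakDual.toStrongDual ⁻¹' Metric.closedBall 0 1))
      ?_ hK.isClosed).trans ?_
    · rintro _ ⟨_, ⟨w, hw, rfl⟩, rfl⟩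
      refine ⟨StrongDual.toWeakDual (NormedSpace.inclusionInDoubleDual ℝ X w), ?_, ?_⟩
      · have := NormedSpace.double_dual_bound ℝ X w
        exact (mem_closedBall_zero_iff (a := NormedSpace.inclusionInDoubleDual ℝ X w)).2
          (this.trans (mem_closedBall_zero_iff.1 hw))
      · rfl
    · rintro _ ⟨φ, -, rfl⟩
      obtain ⟨z, c, hz⟩ := hx (WeakDual.toStrongDual φ)
      refine ⟨toWeakSpace ℝ Y (T z + c • y), ?_⟩
      refine DFunLike.ext _ _ fun g => ?_
      have h1 := hz (A g)
      have h2 : Tendsto (fun n => (A g) z + c * (A g) (x n)) atTop (𝓝 (g (T z + c • y))) := by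
        have := ((hy g).const_mul c).const_add (g (T z))
        simpa [A] using this
      exact tendsto_nhds_unique h2 h1

/-- The iterated limits along `x` of the bilinear form of an operator into the dual that is not
weakly compact exist and are different. -/
theorem exists_iterated_limits {x : ℕ → X} (hspan : BidualSpannedBy x) (hx : WeaklyCauchy x)
    {T : X →L[ℝ] StrongDual ℝ X} (hT : ¬ IsWeaklyCompactOperator T) :
    ∃ c : ℝ, c ≠ 0 ∧ ∃ (r s : ℕ → ℝ) (l : ℝ),
      (∀ n, Tendsto (fun m => T (x n) (x m)) atTop (𝓝 (r n))) ∧ Tendsto r atTop (𝓝 (l + c)) ∧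
      (∀ m, Tendsto (fun n => T (x n) (x m)) atTop (𝓝 (s m))) ∧ Tendsto s atTop (𝓝 l) := by
  obtain ⟨θ, hθ⟩ := hx.exists_weakStar_limit
  set f : StrongDual ℝ X := θ.comp T.flip
  have hf : ∀ z, Tendsto (fun n => T (x n) z) atTop (𝓝 (f z)) := fun z => hθ (T.flip z)
  refine ⟨θ (θ.comp T) - θ f, fun h0 => hT ?_, fun n => θ (T (x n)), fun m => f (x m), θ f,
    fun n => hθ (T (x n)), ?_, fun m => hf (x m), hθ f⟩
  · refine hspan.isWeaklyCompactOperator T (y := f) fun φ => ?_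
    obtain ⟨z, c, hz⟩ := hspan φ
    have key : ∀ g, φ g = g z + c * θ g := fun g =>
      tendsto_nhds_unique (hz g) (((hθ g).const_mul c).const_add _)
    simp only [key]
    refine (hf z).add (Tendsto.const_mul c ?_)
    have := hθ (θ.comp T)
    rwa [sub_eq_zero.1 h0] at this
  · have := hθ (θ.comp T)
    simpa using this

theorem exists_seq_of_iterated_limits {B : ℕ → ℕ → ℝ} {c : ℝ} (η : ℕ → ℝ) (hη : ∀ i, 0 < η i)
    (hη' : Antitone η)
    (h1 : ∀ n, Tendsto (fun m => B n m) atTop (𝓝 c))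
    (h2 : ∀ m, Tendsto (fun n => B n m) atTop (𝓝 0)) :
    ∃ n k : ℕ → ℕ, StrictMono n ∧ StrictMono k ∧
      ∀ i j, |B (n i) (k j) - if i ≤ j then c else 0| ≤ η (max i j) := by
  obtain ⟨f, hf1, hf2⟩ := exists_seq_of_forall_finset_exists
    (fun q : ℕ × ℕ × ℕ => |B q.2.1 q.2.2 - c| ≤ η q.1)
    (fun q q' => q.1 < q'.1 ∧ q.2.1 < q'.2.1 ∧ q.2.2 < q'.2.2 ∧
      |B q'.2.1 q.2.2| ≤ η q'.1 ∧ |B q.2.1 q'.2.2 - c| ≤ η q'.1) (by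
    intro s _
    obtain ⟨t, ht⟩ : ∃ t, ∀ q ∈ s, q.1 < t :=
      ⟨s.sup (fun q => q.1) + 1, fun q hq => Nat.lt_succ_of_le (Finset.le_sup (f := fun q => q.1) hq)⟩
    have e1 : ∀ᶠ n in atTop, ∀ q ∈ s, q.2.1 < n ∧ |B n q.2.2| ≤ η t := by
      refine (Filter.eventually_all_finset s).2 fun q _ => (eventually_gt_atTop _).and ?_
      have := (h2 q.2.2).abs
      rw [abs_zero] at this
      exact (this.eventually (gt_mem_nhds (hη t))).mono fun _ h => h.le
    obtain ⟨n, hn⟩ := e1.exists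
    have e3 : ∀ n, ∀ᶠ k in atTop, |B n k - c| ≤ η t := fun n => by
      have := ((h1 n).sub_const c).abs
      rw [sub_self, abs_zero] at this
      exact (this.eventually (gt_mem_nhds (hη t))).mono fun _ h => h.le
    have e2 : ∀ᶠ k in atTop, ∀ q ∈ s, q.2.2 < k ∧ |B q.2.1 k - c| ≤ η t :=
      (Filter.eventually_all_finset s).2 fun q _ => (eventually_gt_atTop _).and (e3 _)
    obtain ⟨k, hk, hk'⟩ := (e2.and (e3 n)).exists
    exact ⟨(t, n, k), hk', fun q hq =>
      ⟨ht q hq, (hn q hq).1, (hk q hq).1, (hn q hq).2, (hk q hq).2⟩⟩)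
  have ht : StrictMono fun i => (f i).1 := fun i j h => (hf2 i j h).1
  refine ⟨fun i => (f i).2.1, fun i => (f i).2.2, fun i j h => (hf2 i j h).2.1,
    fun i j h => (hf2 i j h).2.2.1, fun i j => ?_⟩
  rcases lt_trichotomy i j with h | rfl | h
  · rw [if_pos h.le, max_eq_right h.le]
    exact (hf2 i j h).2.2.2.2.trans (hη' (ht.id_le j))
  · rw [if_pos le_rfl, max_self]
    exact (hf1 i).trans (hη' (ht.id_le i))
  · rw [if_neg h.not_ge, max_eq_left h.le, sub_zero]
    exact (hf2 j i h).2.2.2.1.trans (hη' (ht.id_le i))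

theorem sum_half_pow_le_two (F : Finset ℕ) : ∑ i ∈ F, (1 / 2 : ℝ) ^ i ≤ 2 := by
  exact (summable_geometric_two.sum_le_tsum F fun i _ => by positivity).trans
    tsum_geometric_two.le

/-- Along subsequences of differences of `x`, an operator into the dual which is not weakly
compact acts as a multiple of the identity up to a summable perturbation. -/
theorem exists_diagonal_estimate {x : ℕ → X} (hspan : BidualSpannedBy x) (hx : WeaklyCauchy x)
    {T : X →L[ℝ] StrongDual ℝ X} (hT : ¬ IsWeaklyCompactOperator T) :
    ∃ (C : ℝ) (n k : ℕ → ℕ), 0 < C ∧ StrictMono n ∧ StrictMono k ∧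
      ∀ (F : Finset ℕ) (a b : ℕ → ℝ) (α β : ℝ), (∀ i ∈ F, |a i| ≤ α) → (∀ i ∈ F, |b i| ≤ β) →
        0 ≤ α → 0 ≤ β →
        |∑ i ∈ F, a i * b i| ≤ C * (‖∑ i ∈ F, a i • (x (n (2 * i + 1)) - x (n (2 * i)))‖ *
          ‖∑ i ∈ F, b i • (x (k (2 * i)) - x (k (2 * i + 1)))‖ + α * β) := by
  obtain ⟨c, hc, r, s, l, hr, hr', hs, hs'⟩ := exists_iterated_limits hspan hx hT
  set B : ℕ → ℕ → ℝ := fun n m => T (x n) (x m) - s m - r n + (l + c) with hB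
  obtain ⟨n, k, hn, hk, hnk⟩ := exists_seq_of_iterated_limits (B := B) (c := c)
    (fun i => (1 / 2 : ℝ) ^ i) (fun i => by positivity)
    (pow_right_anti₀ (by norm_num) (by norm_num))
    (fun n => by
      have := (((hr n).sub hs').sub_const (r n)).add_const (l + c)
      convert this using 2; ring)
    (fun m => by
      have := (((hs m).sub_const (s m)).sub hr').add_const (l + c)
      convert this using 2; ring)
  have hc' : 0 < |c| := abs_pos.2 hc
  refine ⟨(‖T‖ + 16) / |c|, n, k, by positivity, hn, hk, fun F a b α β ha hb hα hβ => ?_⟩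
  set D : ℕ → X := fun i => x (n (2 * i + 1)) - x (n (2 * i)) with hD
  set D' : ℕ → X := fun i => x (k (2 * i)) - x (k (2 * i + 1)) with hD'
  have hent : ∀ i j, |T (D i) (D' j) + if i = j then c else 0| ≤
      4 * ((1 / 2 : ℝ) ^ i * (1 / 2) ^ j) := by
    intro i j
    have hmax : ∀ i' j', i' ∈ ({2 * i, 2 * i + 1} : Finset ℕ) →
        j' ∈ ({2 * j, 2 * j + 1} : Finset ℕ) →
        |B (n i') (k j') - if i' ≤ j' then c else 0| ≤ (1 / 2 : ℝ) ^ i * (1 / 2) ^ j := by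
      intro i' j' hi hj
      refine (hnk i' j').trans ?_
      rw [← pow_add]
      refine pow_le_pow_of_le_one (by norm_num) (by norm_num) ?_
      simp only [Finset.mem_insert, Finset.mem_singleton] at hi hj
      omega
    have e1 := hmax (2 * i) (2 * j) (by simp) (by simp)
    have e2 := hmax (2 * i) (2 * j + 1) (by simp) (by simp)
    have e3 := hmax (2 * i + 1) (2 * j) (by simp) (by simp)
    have e4 := hmax (2 * i + 1) (2 * j + 1) (by simp) (by simp)
    have hTD : T (D i) (D' j) = B (n (2 * i + 1)) (k (2 * j)) - B (n (2 * i)) (k (2 * j))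
        - B (n (2 * i + 1)) (k (2 * j + 1)) + B (n (2 * i)) (k (2 * j + 1)) := by
      simp only [hD, hD', hB, map_sub, sub_apply]
      ring
    rw [hTD]
    rw [abs_le] at *
    rcases lt_trichotomy i j with h | rfl | h
    · rw [if_pos (by omega)] at e1 e2 e3 e4
      rw [if_neg (by omega)]
      constructor <;> linarith [e1.1, e1.2]
    · rw [if_pos (by omega)] at e1 e2 e4
      rw [if_neg (by omega)] at e3
      rw [if_pos rfl]
      constructor <;> linarith [e1.1, e1.2]
    · rw [if_neg (by omega)] at e1 e2 e3 e4
      rw [if_neg (by omega)]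
      constructor <;> linarith [e1.1, e1.2]
  have hexp : T (∑ i ∈ F, a i • D i) (∑ j ∈ F, b j • D' j) + c * ∑ i ∈ F, a i * b i =
      ∑ i ∈ F, ∑ j ∈ F, a i * b j * (T (D i) (D' j) + if i = j then c else 0) := by
    have h1 : c * ∑ i ∈ F, a i * b i =
        ∑ i ∈ F, ∑ j ∈ F, a i * b j * (if i = j then c else 0) := by
      rw [Finset.mul_sum]
      refine Finset.sum_congr rfl fun i hi => ?_
      simp [hi, mul_comm]
    rw [h1]
    simp only [map_sum, map_smul, sum_apply, smul_apply,
      smul_eq_mul, mul_add, Finset.sum_add_distrib, Finset.mul_sum]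
    congr 1
    refine Finset.sum_comm.trans (Finset.sum_congr rfl fun i _ => Finset.sum_congr rfl fun j _ => ?_)
    ring
  have herr : |∑ i ∈ F, ∑ j ∈ F, a i * b j * (T (D i) (D' j) + if i = j then c else 0)| ≤
      16 * (α * β) := by
    calc _ ≤ ∑ i ∈ F, ∑ j ∈ F, α * β * (4 * ((1 / 2 : ℝ) ^ i * (1 / 2) ^ j)) := by
          refine (Finset.abs_sum_le_sum_abs _ _).trans (Finset.sum_le_sum fun i hi =>
            (Finset.abs_sum_le_sum_abs _ _).trans (Finset.sum_le_sum fun j hj => ?_))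
          rw [abs_mul, abs_mul]
          exact mul_le_mul (mul_le_mul (ha i hi) (hb j hj) (abs_nonneg _) hα) (hent i j)
            (abs_nonneg _) (by positivity)
      _ = 4 * (α * β) * ((∑ i ∈ F, (1 / 2 : ℝ) ^ i) * ∑ j ∈ F, (1 / 2 : ℝ) ^ j) := by
          rw [Finset.sum_mul_sum, Finset.mul_sum]
          refine Finset.sum_congr rfl fun i _ => ?_
          rw [Finset.mul_sum]
          exact Finset.sum_congr rfl fun j _ => by ring
      _ ≤ 4 * (α * β) * (2 * 2) := by
          gcongr
          · exact sum_half_pow_le_two F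
          · exact sum_half_pow_le_two F
      _ = 16 * (α * β) := by ring
  have hT' : |T (∑ i ∈ F, a i • D i) (∑ j ∈ F, b j • D' j)| ≤
      ‖T‖ * (‖∑ i ∈ F, a i • D i‖ * ‖∑ j ∈ F, b j • D' j‖) := by
    rw [← mul_assoc]
    exact T.le_opNorm₂ _ _
  have hfin : |c| * |∑ i ∈ F, a i * b i| ≤
      ‖T‖ * (‖∑ i ∈ F, a i • D i‖ * ‖∑ j ∈ F, b j • D' j‖) + 16 * (α * β) := by
    rw [← abs_mul, eq_sub_of_add_eq' hexp]
    exact (abs_sub _ _).trans (by linarith)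
  rw [div_mul_eq_mul_div, le_div_iff₀ hc', mul_comm _ |c|]
  refine hfin.trans ?_
  have : 0 ≤ ‖∑ i ∈ F, a i • D i‖ * ‖∑ j ∈ F, b j • D' j‖ := by positivity
  nlinarith [norm_nonneg T, mul_nonneg hα hβ, mul_nonneg (norm_nonneg T) (mul_nonneg hα hβ)]

section Predual

variable {x : ℕ → X} {σ : ℕ → StrongDual ℝ X} {S : StrongDual ℝ X}

theorem BidualSpannedBy.exists_eq (hspan : BidualSpannedBy x)
    {θ : StrongDual ℝ (StrongDual ℝ X)}
    (hθ : ∀ f : StrongDual ℝ X, Tendsto (fun n => f (x n)) atTop (𝓝 (θ f)))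
    (φ : StrongDual ℝ (StrongDual ℝ X)) :
    ∃ (z : X) (c : ℝ), φ = NormedSpace.inclusionInDoubleDual ℝ X z + c • θ := by
  obtain ⟨z, c, hz⟩ := hspan φ
  refine ⟨z, c, ?_⟩
  ext g
  exact tendsto_nhds_unique (hz g) (((hθ g).const_mul c).const_add _)

theorem exists_tendsto_dual_sequence (hspan : BidualSpannedBy x) (hx : WeaklyCauchy x)
    (hσ : ∀ z, Tendsto (fun n => σ n z) atTop (𝓝 (S z)))
    (hσx : ∀ n, Tendsto (fun m => σ n (x m)) atTop (𝓝 0)) :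
    ∃ θ : StrongDual ℝ (StrongDual ℝ X),
      (∀ f : StrongDual ℝ X, Tendsto (fun n => f (x n)) atTop (𝓝 (θ f))) ∧
      (∀ n, θ (σ n) = 0) ∧
      ∀ φ, ∃ (z : X) (c : ℝ), φ = NormedSpace.inclusionInDoubleDual ℝ X z + c • θ ∧
        Tendsto (fun n => φ (σ n)) atTop (𝓝 (S z)) := by
  obtain ⟨θ, hθ⟩ := hx.exists_weakStar_limit
  have h0 : ∀ n, θ (σ n) = 0 := fun n => tendsto_nhds_unique (hθ (σ n)) (hσx n)
  refine ⟨θ, hθ, h0, fun φ => ?_⟩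
  obtain ⟨z, c, rfl⟩ := hspan.exists_eq hθ φ
  refine ⟨z, c, rfl, ?_⟩
  simpa [h0] using hσ z

theorem weaklyCauchy_dual_sequence (hspan : BidualSpannedBy x) (hx : WeaklyCauchy x)
    (hσ : ∀ z, Tendsto (fun n => σ n z) atTop (𝓝 (S z)))
    (hσx : ∀ n, Tendsto (fun m => σ n (x m)) atTop (𝓝 0)) : WeaklyCauchy σ := by
  obtain ⟨θ, -, -, h⟩ := exists_tendsto_dual_sequence hspan hx hσ hσx
  intro φ
  obtain ⟨z, c, -, hz⟩ := h φ
  exact hz.cauchySeq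

theorem bidualSpannedBy_dual_sequence (hspan : BidualSpannedBy x) (hx : WeaklyCauchy x)
    (hσ : ∀ z, Tendsto (fun n => σ n z) atTop (𝓝 (S z)))
    (hσx : ∀ n, Tendsto (fun m => σ n (x m)) atTop (𝓝 0)) (hS : ∀ m, S (x m) = 1) :
    BidualSpannedBy σ := by
  obtain ⟨θ, hθ, -, h⟩ := exists_tendsto_dual_sequence hspan hx hσ hσx
  have hθS : θ S = 1 := tendsto_nhds_unique (hθ S) (by simp [hS])
  intro Φ
  let f : StrongDual ℝ X := Φ.comp (NormedSpace.inclusionInDoubleDual ℝ X)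
  refine ⟨f - (θ f - Φ θ) • S, θ f - Φ θ, fun φ => ?_⟩
  obtain ⟨z, c, rfl, hz⟩ := h φ
  have hf : Φ (NormedSpace.inclusionInDoubleDual ℝ X z) = f z := rfl
  convert (hz.const_mul (θ f - Φ θ)).const_add _ using 2
  simp [hf, hθS]
  ring

theorem not_weaklySequentiallyComplete_dual (hspan : BidualSpannedBy x) (hx : WeaklyCauchy x)
    (hσ : ∀ z, Tendsto (fun n => σ n z) atTop (𝓝 (S z)))
    (hσx : ∀ n, Tendsto (fun m => σ n (x m)) atTop (𝓝 0)) (hS : ∀ m, S (x m) = 1) :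
    ¬ WeaklySequentiallyComplete (StrongDual ℝ X) := by
  obtain ⟨θ, hθ, h0, h⟩ := exists_tendsto_dual_sequence hspan hx hσ hσx
  intro hc
  obtain ⟨f, hf⟩ := hc σ (weaklyCauchy_dual_sequence hspan hx hσ hσx)
  have hfS : f = S := by
    ext z
    exact tendsto_nhds_unique (hf (NormedSpace.inclusionInDoubleDual ℝ X z)) (hσ z)
  have h1 : θ S = 1 := tendsto_nhds_unique (hθ S) (by simp [hS])
  have h2 : θ S = 0 := by
    rw [← hfS]
    exact tendsto_nhds_unique (hf θ) (by simp [h0])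
  linarith

theorem not_weaklySequentiallyComplete_bidual (hspan : BidualSpannedBy x) (hx : WeaklyCauchy x)
    (hσ : ∀ z, Tendsto (fun n => σ n z) atTop (𝓝 (S z)))
    (hσx : ∀ n, Tendsto (fun m => σ n (x m)) atTop (𝓝 0)) (hS : ∀ m, S (x m) = 1) :
    ¬ WeaklySequentiallyComplete (StrongDual ℝ (StrongDual ℝ X)) := by
  obtain ⟨θ, hθ, h0, h⟩ := exists_tendsto_dual_sequence hspan hx hσ hσx
  obtain ⟨Λ, hΛ⟩ := (weaklyCauchy_dual_sequence hspan hx hσ hσx).exists_weakStar_limit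
  intro hc
  obtain ⟨φ, hφ⟩ := hc (fun n => NormedSpace.inclusionInDoubleDual ℝ X (x n)) fun Φ =>
    hx (Φ.comp (NormedSpace.inclusionInDoubleDual ℝ X))
  have hφθ : φ = θ := by
    ext f
    exact tendsto_nhds_unique (hφ (NormedSpace.inclusionInDoubleDual ℝ (StrongDual ℝ X) f)) (hθ f)
  have h1 : ∀ n, Λ (NormedSpace.inclusionInDoubleDual ℝ X (x n)) = 1 := fun n =>
    tendsto_nhds_unique (hΛ _) (by simpa [hS] using hσ (x n))
  have h2 : Λ θ = 0 := tendsto_nhds_unique (hΛ _) (by simp [h0])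
  have h3 : Λ θ = 1 := by
    rw [← hφθ]
    exact tendsto_nhds_unique (hφ Λ) (by simp [h1])
  linarith

end Predual

end WeakLimits

section Domination

variable {X Y Z : Type*} [NormedAddCommGroup X] [NormedSpace ℝ X]
  [NormedAddCommGroup Y] [NormedSpace ℝ Y] [NormedAddCommGroup Z] [NormedSpace ℝ Z]

theorem sum_support_onFinset_smul (F : Finset ℕ) (a : ℕ → ℝ) (x : ℕ → X)
    (h : ∀ i, (if i ∈ F then a i else 0) ≠ 0 → i ∈ F) :
    ∑ i ∈ (Finsupp.onFinset F (fun i => if i ∈ F then a i else 0) h).support,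
      (Finsupp.onFinset F (fun i => if i ∈ F then a i else 0) h) i • x i = ∑ i ∈ F, a i • x i := by
  rw [Finset.sum_subset Finsupp.support_onFinset_subset
    (fun i _ hi => by rw [Finsupp.notMem_support_iff.1 hi, zero_smul])]
  exact Finset.sum_congr rfl fun i hi => by simp [hi]

theorem dominates_iff {x : ℕ → X} {y : ℕ → Y} :
    Dominates x y ↔ ∃ C : ℝ, 0 ≤ C ∧ ∀ (F : Finset ℕ) (a : ℕ → ℝ),
      ‖∑ i ∈ F, a i • y i‖ ≤ C * ‖∑ i ∈ F, a i • x i‖ := by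
  constructor
  · rintro ⟨C, hC⟩
    refine ⟨|C|, abs_nonneg C, fun F a => ?_⟩
    have := hC (Finsupp.onFinset F (fun i => if i ∈ F then a i else 0) (by simp_all))
    rw [sum_support_onFinset_smul, sum_support_onFinset_smul] at this
    exact this.trans (mul_le_mul_of_nonneg_right (le_abs_self C) (norm_nonneg _))
  · rintro ⟨C, -, hC⟩
    exact ⟨C, fun a => hC a.support a⟩

theorem Dominates.trans {x : ℕ → X} {y : ℕ → Y} {z : ℕ → Z} (h : Dominates x y)
    (h' : Dominates y z) : Dominates x z := by
  obtain ⟨C, -, hC⟩ := dominates_iff.1 h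
  obtain ⟨C', hC0, hC'⟩ := dominates_iff.1 h'
  refine ⟨C' * C, fun a => (hC' _ a).trans ?_⟩
  rw [mul_assoc]
  exact mul_le_mul_of_nonneg_left (hC _ a) hC0

end Domination

section Basis

variable {E : Type*} [NormedAddCommGroup E] [NormedSpace ℝ E]

/-- The coordinate projections of `b` onto finite sets are bounded by `K`. -/
def SuppressionBound (b : SchauderBasis ℝ E) (K : ℝ) : Prop :=
  1 ≤ K ∧ ∀ (A : Finset ℕ) (x : E), ‖∑ i ∈ A, b.coord i x • b i‖ ≤ K * ‖x‖

theorem exists_suppressionBound [CompleteSpace E] {b : SchauderBasis ℝ E}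
    (hb : ∀ x : E, HasSum (fun i => b.coord i x • b i) x) : ∃ K, SuppressionBound b K := by
  let b' : UnconditionalSchauderBasis ℕ ℝ E := ⟨b.basis, b.coord, b.ortho, hb⟩
  obtain ⟨C, hC⟩ := b'.exists_norm_proj_le
  refine ⟨max C 1, le_max_right _ _, fun A x => ?_⟩
  have := (b'.proj A).le_of_opNorm_le (hC A) x
  rw [GeneralSchauderBasis.proj_apply] at this
  exact this.trans (mul_le_mul_of_nonneg_right (le_max_left _ _) (norm_nonneg _))

variable {b : SchauderBasis ℝ E} {K : ℝ}

theorem coord_basis (b : SchauderBasis ℝ E) (i j : ℕ) :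
    b.coord i (b j) = if i = j then 1 else 0 := by
  rw [b.ortho]
  by_cases h : i = j
  · subst h; simp
  · simp [h]

theorem SuppressionBound.pos (hK : SuppressionBound b K) : 0 < K := zero_lt_one.trans_le hK.1

theorem SuppressionBound.abs_coord_le (hK : SuppressionBound b K) (hb : ∀ i, ‖b i‖ = 1)
    (i : ℕ) (x : E) : |b.coord i x| ≤ K * ‖x‖ := by
  have := hK.2 {i} x
  rwa [Finset.sum_singleton, norm_smul, hb, mul_one] at this

theorem coord_sum_of_injOn {F : Finset ℕ} {l : ℕ → ℕ} (hl : Set.InjOn l F) (a : ℕ → ℝ) {j : ℕ}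
    (hj : j ∈ F) : b.coord (l j) (∑ i ∈ F, a i • b (l i)) = a j := by
  rw [map_sum, Finset.sum_eq_single_of_mem j hj]
  · simp [coord_basis]
  · intro i hi hij
    have : l j ≠ l i := fun h => hij (hl hi hj h.symm)
    simp [coord_basis, this]

theorem SuppressionBound.norm_sum_subset_le (hK : SuppressionBound b K) {I F : Finset ℕ}
    (hI : I ⊆ F) {l : ℕ → ℕ} (hl : Set.InjOn l F) (a : ℕ → ℝ) :
    ‖∑ i ∈ I, a i • b (l i)‖ ≤ K * ‖∑ i ∈ F, a i • b (l i)‖ := by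
  classical
  have := hK.2 (I.image l) (∑ i ∈ F, a i • b (l i))
  rw [Finset.sum_image (hl.mono (Finset.coe_subset.2 hI))] at this
  convert this using 4 with i hi
  exact (coord_sum_of_injOn hl a (hI hi)).symm

theorem SuppressionBound.abs_le_norm_sum (hK : SuppressionBound b K) (hb : ∀ i, ‖b i‖ = 1)
    {F : Finset ℕ} {l : ℕ → ℕ} (hl : Set.InjOn l F) (a : ℕ → ℝ) {j : ℕ} (hj : j ∈ F) :
    |a j| ≤ K * ‖∑ i ∈ F, a i • b (l i)‖ := by
  have := hK.abs_coord_le hb (l j) (∑ i ∈ F, a i • b (l i))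
  rwa [coord_sum_of_injOn hl a hj] at this

/-- Failure of a uniform estimate between images of basis sequences can be localized far out. -/
theorem SuppressionBound.exists_bad_tail (hK : SuppressionBound b K) (hb : ∀ i, ‖b i‖ = 1)
    (h : ∀ C : ℝ, ∃ (I : Finset ℕ) (l m : ℕ → ℕ) (a : ℕ → ℝ), StrictMonoOn l I ∧
      StrictMonoOn m I ∧ C * ‖∑ j ∈ I, a j • b (m j)‖ < ‖∑ j ∈ I, a j • b (l j)‖)
    (C : ℝ) (hC : 0 ≤ C) (N : ℕ) :
    ∃ (I : Finset ℕ) (l m : ℕ → ℕ) (a : ℕ → ℝ), StrictMonoOn l I ∧ StrictMonoOn m I ∧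
      (∀ j ∈ I, N ≤ j ∧ N ≤ l j ∧ N ≤ m j) ∧
      C * ‖∑ j ∈ I, a j • b (m j)‖ < ‖∑ j ∈ I, a j • b (l j)‖ := by
  classical
  obtain ⟨I, l, m, a, hl, hm, hbad⟩ := h (C * K + 3 * N * K)
  set p : ℕ → Prop := fun j => N ≤ j ∧ N ≤ l j ∧ N ≤ m j with hp
  have hsub : (I.filter p : Set ℕ) ⊆ I := Finset.coe_subset.2 (Finset.filter_subset _ _)
  refine ⟨I.filter p, l, m, a, hl.mono hsub, hm.mono hsub,
    fun j hj => (Finset.mem_filter.1 hj).2, ?_⟩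
  have hcard : ((I.filter fun j => ¬ p j).card : ℝ) ≤ 3 * N := by
    have h1 : (I.filter fun j => ¬ p j) ⊆ (I.filter fun j => j < N) ∪
        ((I.filter fun j => l j < N) ∪ (I.filter fun j => m j < N)) := by
      intro j hj
      simp only [Finset.mem_filter, Finset.mem_union, hp] at hj ⊢
      have := hj.1
      have h2 := hj.2
      simp only [this, true_and]
      omega
    have hle : ∀ q : ℕ → ℕ, Set.InjOn q I → (I.filter fun j => q j < N).card ≤ N := by
      intro q hq
      have := Finset.card_le_card_of_injOn (s := I.filter fun j => q j < N)
        (t := Finset.range N) q (fun j hj => by simpa using (Finset.mem_filter.1 hj).2)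
        (hq.mono (Finset.coe_subset.2 (Finset.filter_subset _ _)))
      simpa using this
    have h2 := (Finset.card_le_card h1).trans ((Finset.card_union_le _ _).trans
      (add_le_add_right (Finset.card_union_le _ _) _))
    have h3 := hle id (Set.injOn_id _)
    have h4 := hle l hl.injOn
    have h5 := hle m hm.injOn
    simp only [id] at h3
    have h6 : (I.filter fun j => ¬ p j).card ≤ 3 * N := by omega
    exact_mod_cast h6
  set V := ‖∑ j ∈ I, a j • b (m j)‖ with hV
  have hrest : ‖∑ j ∈ I.filter (fun j => ¬ p j), a j • b (l j)‖ ≤ 3 * N * K * V := by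
    calc _ ≤ ∑ j ∈ I.filter (fun j => ¬ p j), K * V := by
          refine norm_sum_le_of_le _ fun j hj => ?_
          rw [norm_smul, hb, mul_one]
          exact hK.abs_le_norm_sum hb hm.injOn a (Finset.mem_filter.1 hj).1
      _ = (I.filter fun j => ¬ p j).card * (K * V) := by rw [Finset.sum_const, nsmul_eq_mul]
      _ ≤ 3 * N * (K * V) := mul_le_mul_of_nonneg_right hcard
          (mul_nonneg hK.pos.le (norm_nonneg _))
      _ = 3 * N * K * V := by ring
  have hsplit := Finset.sum_filter_add_sum_filter_not I p (fun j => a j • b (l j))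
  rw [← hsplit] at hbad
  have h1 := norm_add_le (∑ j ∈ I.filter p, a j • b (l j))
    (∑ j ∈ I.filter (fun j => ¬ p j), a j • b (l j))
  have h2 : C * ‖∑ j ∈ I.filter p, a j • b (m j)‖ ≤ C * (K * V) :=
    mul_le_mul_of_nonneg_left
      (hK.norm_sum_subset_le (Finset.filter_subset p I) hm.injOn a) hC
  nlinarith

/-- All increasing rearrangements of finite sums along a subsymmetric basis are uniformly
equivalent. -/
theorem SuppressionBound.exists_uniform_equivalence (hK : SuppressionBound b K)
    (hb : ∀ i, ‖b i‖ = 1)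
    (hsub : ∀ n : ℕ → ℕ, StrictMono n → SeqEquivalent (fun i => b (n i)) (fun i => b i)) :
    ∃ C : ℝ, 0 ≤ C ∧ ∀ (I : Finset ℕ) (l m : ℕ → ℕ) (a : ℕ → ℝ), StrictMonoOn l I →
      StrictMonoOn m I → ‖∑ j ∈ I, a j • b (l j)‖ ≤ C * ‖∑ j ∈ I, a j • b (m j)‖ := by
  classical
  by_contra hcon
  have h : ∀ C : ℝ, ∃ (I : Finset ℕ) (l m : ℕ → ℕ) (a : ℕ → ℝ), StrictMonoOn l I ∧
      StrictMonoOn m I ∧ C * ‖∑ j ∈ I, a j • b (m j)‖ < ‖∑ j ∈ I, a j • b (l j)‖ := by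
    intro C
    by_contra hC
    push Not at hC
    refine hcon ⟨max C 0, le_max_right _ _, fun I l m a hl hm => (hC I l m a hl hm).trans ?_⟩
    exact mul_le_mul_of_nonneg_right (le_max_left _ _) (norm_nonneg _)
  obtain ⟨f, hf1, hf2⟩ := exists_seq_of_forall_finset_exists
    (fun q : ℕ × Finset ℕ × (ℕ → ℕ) × (ℕ → ℕ) × (ℕ → ℝ) =>
      StrictMonoOn q.2.2.1 q.2.1 ∧ StrictMonoOn q.2.2.2.1 q.2.1 ∧
      (q.1 : ℝ) * ‖∑ j ∈ q.2.1, q.2.2.2.2 j • b (q.2.2.2.1 j)‖ <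
        ‖∑ j ∈ q.2.1, q.2.2.2.2 j • b (q.2.2.1 j)‖)
    (fun q q' => q.1 < q'.1 ∧ ∀ i ∈ q.2.1, ∀ j ∈ q'.2.1,
      i < j ∧ q.2.2.1 i < q'.2.2.1 j ∧ q.2.2.2.1 i < q'.2.2.2.1 j) (by
    intro s _
    set N : ℕ := s.sup (fun q => q.1 + q.2.1.sup (fun i => i + q.2.2.1 i + q.2.2.2.1 i)) + 1
    have hN : ∀ q ∈ s, q.1 < N ∧ ∀ i ∈ q.2.1, i < N ∧ q.2.2.1 i < N ∧ q.2.2.2.1 i < N := by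
      intro q hq
      have h1 := Finset.le_sup (f := fun q : ℕ × Finset ℕ × (ℕ → ℕ) × (ℕ → ℕ) × (ℕ → ℝ) =>
        q.1 + q.2.1.sup (fun i => i + q.2.2.1 i + q.2.2.2.1 i)) hq
      refine ⟨by grind, fun i hi => ?_⟩
      have h2 := Finset.le_sup (f := fun i => i + q.2.2.1 i + q.2.2.2.1 i) hi
      grind
    obtain ⟨I, l, m, a, hl, hm, hI, hbad⟩ := hK.exists_bad_tail hb h N (Nat.cast_nonneg N) N
    refine ⟨(N, I, l, m, a), ⟨hl, hm, hbad⟩, fun q hq => ⟨(hN q hq).1, fun i hi j hj => ?_⟩⟩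
    have h1 := (hN q hq).2 i hi
    have h2 := hI j hj
    exact ⟨by grind, by grind, by grind⟩)
  set I : ℕ → Finset ℕ := fun k => (f k).2.1 with hI
  have hdisj : ∀ k k' j, j ∈ I k → j ∈ I k' → k = k' := by
    intro k k' j hj hj'
    rcases lt_trichotomy k k' with hlt | h' | hlt
    · exact absurd ((hf2 k k' hlt).2 j hj j hj').1 (lt_irrefl _)
    · exact h'
    · exact absurd ((hf2 k' k hlt).2 j hj' j hj).1 (lt_irrefl _)
  set g : ℕ → ℕ := fun j => if h : ∃ k, j ∈ I k then h.choose else 0 with hg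
  have hgI : ∀ k, ∀ j ∈ I k, g j = k := by
    intro k j hj
    have hex : ∃ k, j ∈ I k := ⟨k, hj⟩
    simp only [hg, dif_pos hex]
    exact hdisj _ _ j hex.choose_spec hj
  set L : ℕ → ℕ := fun j => (f (g j)).2.2.1 j with hL
  set M : ℕ → ℕ := fun j => (f (g j)).2.2.2.1 j with hM
  set U : Set ℕ := {j | ∃ k, j ∈ I k} with hU
  have hlt : ∀ i ∈ U, ∀ j ∈ U, i < j → L i < L j ∧ M i < M j := by
    rintro i ⟨k, hi⟩ j ⟨k', hj⟩ hij
    simp only [hL, hM, hgI k i hi, hgI k' j hj]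
    rcases lt_trichotomy k k' with h' | rfl | h'
    · exact ((hf2 k k' h').2 i hi j hj).2
    · exact ⟨(hf1 k).1 hi hj hij, (hf1 k).2.1 hi hj hij⟩
    · exact absurd ((hf2 k' k h').2 j hj i hi).1 hij.not_gt
  have hne : ∀ k, (I k).Nonempty := by
    intro k
    rw [Finset.nonempty_iff_ne_empty]
    intro h0
    have := (hf1 k).2.2
    simp only [hI] at h0
    simp [h0] at this
  have hinf : U.Infinite := by
    choose c hc using hne
    exact Set.infinite_of_injective_forall_mem (f := c)
      (fun k k' hkk => hdisj k k' (c k) (hc k) (hkk ▸ hc k')) fun k => ⟨k, hc k⟩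
  set n : ℕ → ℕ := Nat.nth (· ∈ U) with hn
  have hnm : StrictMono n := Nat.nth_strictMono hinf
  have hnU : ∀ r, n r ∈ U := fun r => Nat.nth_mem_of_infinite hinf r
  have hLn : StrictMono (L ∘ n) := fun r s hrs => (hlt _ (hnU r) _ (hnU s) (hnm hrs)).1
  have hMn : StrictMono (M ∘ n) := fun r s hrs => (hlt _ (hnU r) _ (hnU s) (hnm hrs)).2
  obtain ⟨C, hC0, hC⟩ := dominates_iff.1 ((hsub _ hMn).1.trans (hsub _ hLn).2)
  obtain ⟨k, hk⟩ := exists_nat_ge C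
  have hkk : C ≤ ((f k).1 : ℝ) := by
    have : StrictMono fun i => (f i).1 := fun i j hij => (hf2 i j hij).1
    exact hk.trans (by exact_mod_cast this.id_le k)
  have hbad := (hf1 k).2.2
  set a := (f k).2.2.2.2 with ha
  have := hC ((I k).preimage n hnm.injective.injOn) (fun r => a (n r))
  have hrange : ∀ x ∈ I k, x ∉ Set.range n → False := by
    intro x hx hx'
    have hr : Set.range n = U := Nat.range_nth_of_infinite hinf
    exact hx' (hr ▸ ⟨k, hx⟩)
  simp only [Function.comp] at this
  rw [Finset.sum_preimage n (I k) hnm.injective.injOn (fun j => a j • b (L j))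
      (fun x hx hx' => (hrange x hx hx').elim),
    Finset.sum_preimage n (I k) hnm.injective.injOn (fun j => a j • b (M j))
      (fun x hx hx' => (hrange x hx hx').elim),
    Finset.sum_congr rfl (g := fun j => a j • b ((f k).2.2.1 j))
      (fun j hj => by simp only [hL, hgI k j hj]),
    Finset.sum_congr rfl (g := fun j => a j • b ((f k).2.2.2.1 j)) (s₁ := I k)
      (f := fun j => a j • b (M j)) (fun j hj => by simp only [hM, hgI k j hj])] at this
  exact absurd (hbad.trans_le this) (not_lt.2 (mul_le_mul_of_nonneg_right hkk (norm_nonneg _)))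

/-- A basis of a reflexive space is boundedly complete. -/
theorem IsReflexiveSpace.exists_tendsto_sum (hE : IsReflexiveSpace E) (b : SchauderBasis ℝ E)
    {a : ℕ → ℝ} {Λ : ℝ} (ha : ∀ n, ‖∑ i ∈ Finset.range n, a i • b i‖ ≤ Λ) :
    ∃ y, Tendsto (fun n => ∑ i ∈ Finset.range n, a i • b i) atTop (𝓝 y) := by
  set y : ℕ → E := fun n => ∑ i ∈ Finset.range n, a i • b i with hy
  set G : ℕ → WeakDual ℝ (StrongDual ℝ E) := fun n =>
    StrongDual.toWeakDual (NormedSpace.inclusionInDoubleDual ℝ E (y n)) with hG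
  have hcpt : IsCompact (WeakDual.toStrongDual ⁻¹' Metric.closedBall
      (0 : StrongDual ℝ (StrongDual ℝ E)) Λ) :=
    WeakDual.isCompact_closedBall (𝕜 := ℝ) (E := StrongDual ℝ E) 0 Λ
  obtain ⟨φ, -, hφ⟩ := isCompact_iff_ultrafilter_le_nhds.1 hcpt
    ((hyperfilter ℕ).map G) (by
      rw [Ultrafilter.coe_map, le_principal_iff, mem_map]
      refine Filter.univ_mem' fun n => ?_
      refine (mem_closedBall_zero_iff (a := NormedSpace.inclusionInDoubleDual ℝ E (y n))).2 ?_
      exact (NormedSpace.double_dual_bound ℝ E (y n)).trans (ha n))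
  obtain ⟨z, hz⟩ := hE (WeakDual.toStrongDual φ)
  have hcoord : ∀ i, b.coord i z = a i := by
    intro i
    have h1 : Tendsto (fun n => b.coord i (y n)) (hyperfilter ℕ) (𝓝 (b.coord i z)) := by
      have : Tendsto (fun n => (G n) (b.coord i)) (hyperfilter ℕ) (𝓝 (φ (b.coord i))) :=
        ((WeakDual.eval_continuous (b.coord i)).tendsto φ).comp hφ
      have h3 : φ (b.coord i) = b.coord i z := by
        have := congrArg (fun ψ => ψ (b.coord i)) hz
        exact this.symm
      rw [h3] at this
      exact this
    have h2 : Tendsto (fun n => b.coord i (y n)) (hyperfilter ℕ) (𝓝 (a i)) := by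
      refine Tendsto.mono_left ?_ Nat.hyperfilter_le_atTop
      refine tendsto_const_nhds.congr' ?_
      filter_upwards [eventually_gt_atTop i] with n hn
      exact (coord_sum_of_injOn (l := id) (Set.injOn_id _) a (Finset.mem_range.2 hn)).symm
    exact tendsto_nhds_unique h1 h2
  refine ⟨z, ?_⟩
  have := SchauderBasis.tendsto_proj b z
  simpa [SchauderBasis.proj_apply, hcoord] using this

theorem SuppressionBound.norm_sum_coord_le (hK : SuppressionBound b K) {F : Finset ℕ}
    {a : ℕ → ℝ} {C : ℝ} (hC : 0 ≤ C)
    (h : ∀ t : ℕ → ℝ, |∑ i ∈ F, a i * t i| ≤ C * ‖∑ i ∈ F, t i • b i‖) :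
    ‖∑ i ∈ F, a i • b.coord i‖ ≤ C * K := by
  refine ContinuousLinearMap.opNorm_le_bound _ (mul_nonneg hC hK.pos.le) fun x => ?_
  have h1 := h fun i => b.coord i x
  have h2 := mul_le_mul_of_nonneg_left (hK.2 F x) hC
  rw [mul_assoc, Real.norm_eq_abs]
  simpa [sum_apply] using h1.trans h2

theorem SuppressionBound.norm_sum_basis_le (hK : SuppressionBound b K) {F : Finset ℕ}
    {a : ℕ → ℝ} {C : ℝ} (hC : 0 ≤ C)
    (h : ∀ t : ℕ → ℝ, |∑ i ∈ F, a i * t i| ≤ C * ‖∑ i ∈ F, t i • b.coord i‖) :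
    ‖∑ i ∈ F, a i • b i‖ ≤ C * K := by
  obtain ⟨g, hg, hgx⟩ := exists_dual_vector'' ℝ (∑ i ∈ F, a i • b i)
  have h1 := h fun i => g (b i)
  have h2 : ‖∑ i ∈ F, g (b i) • b.coord i‖ ≤ K := by
    refine ContinuousLinearMap.opNorm_le_bound _ hK.pos.le fun x => ?_
    have h3 : (∑ i ∈ F, g (b i) • b.coord i) x = g (∑ i ∈ F, b.coord i x • b i) := by
      simp [sum_apply, mul_comm]
    rw [h3]
    refine (g.le_of_opNorm_le hg _).trans ?_
    rw [one_mul]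
    exact hK.2 F x
  have h4 : ‖∑ i ∈ F, a i • b i‖ = ∑ i ∈ F, a i * g (b i) := by
    rw [map_sum] at hgx
    simpa using hgx.symm
  rw [h4]
  exact (le_abs_self _).trans (h1.trans (mul_le_mul_of_nonneg_left h2 hC))

end Basis

section LeftEnd

/-- `l` maps every index to the left end of its interval, for some partition of `ℕ` into
intervals. -/
structure IsLeftEnd (l : ℕ → ℕ) : Prop where
  le_self : ∀ j, l j ≤ j
  eq_of_le : ∀ i j, l j ≤ i → i ≤ j → l i = l j

theorem IsLeftEnd.monotone {l : ℕ → ℕ} (hl : IsLeftEnd l) : Monotone l := by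
  intro i j hij
  rcases le_or_gt (l j) i with h | h
  · exact (hl.eq_of_le i j h hij).le
  · exact (hl.le_self i).trans h.le

theorem isLeftEnd_id : IsLeftEnd id := ⟨fun _ => le_rfl, fun _ _ h h' => le_antisymm h' h⟩

theorem isLeftEnd_zero : IsLeftEnd fun _ => 0 := ⟨fun _ => Nat.zero_le _, fun _ _ _ _ => rfl⟩

/-- The index `i` with `s i ≤ j < s (i + 1)`. -/
def blockIndex (s : ℕ → ℕ) (j : ℕ) : ℕ := Nat.findGreatest (fun i => s i ≤ j) j

variable {s : ℕ → ℕ}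

theorem le_blockIndex {j : ℕ} (h0 : s 0 ≤ j) : s (blockIndex s j) ≤ j :=
  Nat.findGreatest_spec (P := fun i => s i ≤ j) (Nat.zero_le j) h0

theorem lt_blockIndex_succ (hs : StrictMono s) (j : ℕ) : j < s (blockIndex s j + 1) := by
  by_contra h
  push Not at h
  have h1 : blockIndex s j + 1 ≤ j := (hs.id_le _).trans h
  exact absurd (Nat.le_findGreatest (P := fun i => s i ≤ j) h1 h) (Nat.not_succ_le_self _)

theorem blockIndex_eq (hs : StrictMono s) {i j : ℕ} (h1 : s i ≤ j) (h2 : j < s (i + 1)) :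
    blockIndex s j = i := by
  have h0 : s 0 ≤ j := (hs.monotone (Nat.zero_le i)).trans h1
  have h3 := hs.lt_iff_lt.1 ((le_blockIndex h0).trans_lt h2)
  have h4 := hs.lt_iff_lt.1 (h1.trans_lt (lt_blockIndex_succ hs j))
  omega

/-- The left ends of the partition which refines the intervals `[s i, s (i + 1))` by the
partitions given by `l i`. -/
def glueLeftEnd (s : ℕ → ℕ) (l : ℕ → ℕ → ℕ) (j : ℕ) : ℕ :=
  if s 0 ≤ j then max (s (blockIndex s j)) (l (blockIndex s j) j) else 0

theorem glueLeftEnd_eq (hs : StrictMono s) (l : ℕ → ℕ → ℕ) {i j : ℕ} (h1 : s i ≤ j)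
    (h2 : j < s (i + 1)) : glueLeftEnd s l j = max (s i) (l i j) := by
  rw [glueLeftEnd, if_pos ((hs.monotone (Nat.zero_le i)).trans h1), blockIndex_eq hs h1 h2]

theorem isLeftEnd_glueLeftEnd (hs : StrictMono s) {l : ℕ → ℕ → ℕ} (hl : ∀ i, IsLeftEnd (l i)) :
    IsLeftEnd (glueLeftEnd s l) := by
  constructor
  · intro j
    rw [glueLeftEnd]
    split_ifs with h
    · exact max_le (le_blockIndex h) ((hl _).le_self j)
    · exact Nat.zero_le j
  · intro i j hi hij
    by_cases h : s 0 ≤ j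
    · have h1 := le_blockIndex h
      have h2 := lt_blockIndex_succ hs j
      rw [glueLeftEnd_eq hs l h1 h2] at hi ⊢
      rw [glueLeftEnd_eq hs l ((le_max_left _ _).trans hi) (hij.trans_lt h2),
        (hl _).eq_of_le i j ((le_max_right _ _).trans hi) hij]
    · rw [glueLeftEnd, glueLeftEnd, if_neg h, if_neg (fun h' => h (h'.trans hij))]

theorem glueLeftEnd_zero_eq_iff (hs : StrictMono s) {i j : ℕ} :
    glueLeftEnd s (fun _ _ => 0) j = s i ↔ s i ≤ j ∧ j < s (i + 1) := by
  constructor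
  · intro h
    by_cases h0 : s 0 ≤ j
    · have h1 := le_blockIndex h0
      have h2 := lt_blockIndex_succ hs j
      rw [glueLeftEnd_eq hs _ h1 h2, max_eq_left (Nat.zero_le _)] at h
      rw [← hs.injective h]
      exact ⟨h1, h2⟩
    · rw [glueLeftEnd, if_neg h0] at h
      have := hs.monotone (Nat.zero_le i)
      omega
  · rintro ⟨h1, h2⟩
    rw [glueLeftEnd_eq hs _ h1 h2, max_eq_left (Nat.zero_le _)]

theorem sum_range_sum_Ico {M : Type*} [AddCommMonoid M] (g : ℕ → M) {p : ℕ → ℕ}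
    (hp : Monotone p) (hp0 : p 0 = 0) (k : ℕ) :
    ∑ i ∈ Finset.range k, ∑ j ∈ Finset.Ico (p i) (p (i + 1)), g j =
      ∑ j ∈ Finset.range (p k), g j := by
  induction k with
  | zero => simp [hp0]
  | succ k ih =>
    rw [Finset.sum_range_succ, ih, Finset.range_eq_Ico, Finset.range_eq_Ico,
      Finset.sum_Ico_consecutive g (Nat.zero_le _) (hp (Nat.le_succ k))]

variable {E : Type*} [NormedAddCommGroup E] [NormedSpace ℝ E]

/-- The representative of `∑ aⱼ uⱼ` for the partition with left ends given by `l`. -/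
noncomputable def leftSum (e : ℕ → E) (l : ℕ → ℕ) : (ℕ →₀ ℝ) →ₗ[ℝ] E :=
  Finsupp.linearCombination ℝ fun j => e (l j)

theorem leftSum_single (e : ℕ → E) (l : ℕ → ℕ) (j : ℕ) (t : ℝ) :
    leftSum e l (Finsupp.single j t) = t • e (l j) := by
  simp [leftSum]

theorem leftSum_eq_sum (e : ℕ → E) (l : ℕ → ℕ) {a : ℕ →₀ ℝ} {F : Finset ℕ}
    (h : a.support ⊆ F) : leftSum e l a = ∑ j ∈ F, a j • e (l j) := by
  rw [leftSum, Finsupp.linearCombination_apply,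
    Finsupp.sum_of_support_subset a h (fun j t => t • e (l j)) (fun _ _ => zero_smul _ _)]

theorem jamesRepr_eq_sum (e : ℕ → E) (a : ℕ →₀ ℝ) {k : ℕ} {p l : ℕ → ℕ} (hp : Monotone p)
    (hp0 : p 0 = 0) (h : ∀ i < k, ∀ j, p i ≤ j → j < p (i + 1) → l j = p i) :
    jamesRepr e a k p = ∑ j ∈ Finset.range (p k), a j • e (l j) := by
  rw [← sum_range_sum_Ico _ hp hp0, jamesRepr]
  refine Finset.sum_congr rfl fun i hi => ?_
  rw [Finset.sum_smul]
  refine Finset.sum_congr rfl fun j hj => ?_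
  rw [h i (Finset.mem_range.1 hi) j (Finset.mem_Ico.1 hj).1 (Finset.mem_Ico.1 hj).2]

theorem norm_leftSum_le (e : ℕ → E) {l : ℕ → ℕ} (hl : IsLeftEnd l) (a : ℕ →₀ ℝ) :
    ‖leftSum e l a‖ ≤ jamesNorm e a := by
  classical
  set N := a.support.sup id + 1 with hN
  have hsupp : a.support ⊆ Finset.range N := fun j hj =>
    Finset.mem_range.2 (Nat.lt_succ_of_le (Finset.le_sup (f := id) hj))
  set B : ℕ → Prop := fun j => l j = j ∨ N ≤ j with hB
  have hinf : {j | B j}.Infinite := (Set.Ici_infinite N).mono fun j hj => Or.inr hj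
  set p := Nat.nth B with hp
  have hpm : StrictMono p := Nat.nth_strictMono hinf
  have hpB : ∀ i, B (p i) := Nat.nth_mem_of_infinite hinf
  have hex : ∀ j, B j → ∃ i, p i = j := fun j hj => ⟨_, Nat.nth_count hj⟩
  have hp0 : p 0 = 0 := by
    obtain ⟨i, hi⟩ := hex 0 (Or.inl (Nat.le_zero.1 (hl.le_self 0)))
    have := hpm.monotone (Nat.zero_le i)
    omega
  obtain ⟨k, hk⟩ := hex N (Or.inr le_rfl)
  have hrep : jamesRepr e a k p = leftSum e l a := by
    rw [leftSum_eq_sum e l hsupp, ← hk]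
    refine jamesRepr_eq_sum e a hpm.monotone hp0 fun i hi j h1 h2 => ?_
    have hlj : B (l j) := Or.inl (hl.eq_of_le (l j) j le_rfl (hl.le_self j))
    obtain ⟨r, hr⟩ := hex _ hlj
    have h3 : p r < p (i + 1) := hr ▸ (hl.le_self j).trans_lt h2
    have h4 : l j ≤ p i := hr ▸ hpm.monotone (Nat.lt_succ_iff.1 (hpm.lt_iff_lt.1 h3))
    rw [← hl.eq_of_le _ _ h4 h1]
    rcases hpB i with h | h
    · exact h
    · have := hpm hi
      omega
  rw [← hrep]
  exact norm_jamesRepr_le e a k hpm hp0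

variable {b : SchauderBasis ℝ E} {K : ℝ}

theorem coord_leftSum (b : SchauderBasis ℝ E) (l : ℕ → ℕ) (a : ℕ →₀ ℝ) (k : ℕ) :
    b.coord k (leftSum b l a) = a.sum fun j t => if l j = k then t else 0 := by
  rw [leftSum, Finsupp.linearCombination_apply, Finsupp.sum, map_sum]
  refine Finset.sum_congr rfl fun j _ => ?_
  by_cases h : l j = k
  · simp [coord_basis, h]
  · simp [coord_basis, h, Ne.symm h]

theorem coord_leftSum_eq_zero {l : ℕ → ℕ} {a : ℕ →₀ ℝ} {k : ℕ}
    (h : ∀ j, a j ≠ 0 → l j ≠ k) : b.coord k (leftSum b l a) = 0 := by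
  rw [coord_leftSum]
  exact Finset.sum_eq_zero fun j hj => if_neg (h j (Finsupp.mem_support_iff.1 hj))

theorem sum_coord_leftSum (b : SchauderBasis ℝ E) (l : ℕ → ℕ) (a : ℕ →₀ ℝ) (n : ℕ) :
    ∑ i ∈ Finset.range n, b.coord i (leftSum b l a) • b i =
      leftSum b l (a.filter fun j => l j < n) := by
  induction a using Finsupp.induction_linear with
  | zero => simp [Finsupp.filter_zero]
  | add f g hf hg => simp [Finsupp.filter_add, add_smul, Finset.sum_add_distrib, hf, hg]
  | single j t =>
    rw [leftSum_single]
    by_cases h : l j < n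
    · rw [Finsupp.filter_single_of_pos (fun j => l j < n) h, leftSum_single,
        Finset.sum_eq_single_of_mem (l j) (Finset.mem_range.2 h)]
      · simp [coord_basis]
      · intro i _ hi
        simp [coord_basis, hi]
    · rw [Finsupp.filter_single_of_neg (fun j => l j < n) h, map_zero]
      refine Finset.sum_eq_zero fun i hi => ?_
      have : i ≠ l j := fun h' => h (h' ▸ Finset.mem_range.1 hi)
      simp [coord_basis, this]

theorem leftSum_filter_congr (e : ℕ → E) {l l' : ℕ → ℕ} {q : ℕ → Prop} [DecidablePred q]
    (a : ℕ →₀ ℝ) (h : ∀ j, q j → l j = l' j) :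
    leftSum e l (a.filter q) = leftSum e l' (a.filter q) := by
  rw [leftSum_eq_sum e l subset_rfl, leftSum_eq_sum e l' subset_rfl]
  refine Finset.sum_congr rfl fun j hj => ?_
  rw [Finsupp.support_filter, Finset.mem_filter] at hj
  rw [h j hj.2]

theorem SuppressionBound.jamesNorm_le (hK : SuppressionBound b K) {a : ℕ →₀ ℝ} {M : ℝ}
    (h : ∀ l, IsLeftEnd l → ‖leftSum b l a‖ ≤ M) : jamesNorm b.basis a ≤ K * M := by
  refine _root_.jamesNorm_le _ _ fun k p hp hp0 => ?_
  set l := glueLeftEnd p fun _ _ => 0 with hl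
  have hle : IsLeftEnd l := isLeftEnd_glueLeftEnd hp fun _ => isLeftEnd_zero
  have hlt : ∀ j, l j < p k ↔ j < p k := by
    refine fun j => ⟨fun h => ?_, fun h => (hle.le_self j).trans_lt h⟩
    by_contra hj
    push Not at hj
    have h1 : l (p k) = p k := (glueLeftEnd_zero_eq_iff hp).2 ⟨le_rfl, hp (Nat.lt_succ_self k)⟩
    exact absurd (hle.monotone hj) (by omega)
  have hrep : jamesRepr b.basis a k p =
      ∑ i ∈ Finset.range (p k), b.coord i (leftSum b l a) • b i := by
    rw [sum_coord_leftSum, jamesRepr_eq_sum (l := l) b.basis a hp.monotone hp0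
      (fun i _ j h1 h2 => (glueLeftEnd_zero_eq_iff hp).2 ⟨h1, h2⟩),
      leftSum_eq_sum b.basis l (F := Finset.range (p k))]
    · refine Finset.sum_congr rfl fun j hj => ?_
      rw [Finsupp.filter_apply_pos (fun j => l j < p k) _ ((hlt j).2 (Finset.mem_range.1 hj))]
    · intro j hj
      rw [Finsupp.support_filter, Finset.mem_filter] at hj
      exact Finset.mem_range.2 ((hlt j).1 hj.2)
  rw [hrep]
  exact (hK.2 _ _).trans (mul_le_mul_of_nonneg_left (h l hle) hK.pos.le)

theorem SuppressionBound.jamesNorm_filter_lt_le (hK : SuppressionBound b K) (a : ℕ →₀ ℝ)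
    (n : ℕ) : jamesNorm b.basis (a.filter (· < n)) ≤ K * (K * jamesNorm b.basis a) := by
  refine hK.jamesNorm_le fun l hl => ?_
  set L : ℕ → ℕ := fun j => if j < n then l j else max n (l j) with hL
  have hLE : IsLeftEnd L := by
    constructor
    · intro j
      simp only [hL]
      have := hl.le_self j
      split_ifs <;> omega
    · intro i j h1 h2
      simp only [hL] at h1 ⊢
      by_cases hj : j < n
      · rw [if_pos hj] at h1 ⊢
        rw [if_pos (h2.trans_lt hj)]
        exact hl.eq_of_le i j h1 h2
      · rw [if_neg hj] at h1 ⊢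
        rw [if_neg (by omega), hl.eq_of_le i j (by omega) h2]
  have hlt : (fun j => L j < n) = fun j => j < n := by
    funext j
    simp only [hL]
    have := hl.le_self j
    split_ifs with h
    · simp only [h, iff_true, eq_iff_iff]; omega
    · simp only [h, eq_iff_iff, iff_false]; omega
  have h1 := sum_coord_leftSum b L a n
  simp only [hlt] at h1
  rw [leftSum_filter_congr (l := l) (l' := L) b.basis a (fun j hj => by simp [hL, hj]), ← h1]
  exact (hK.2 _ _).trans (mul_le_mul_of_nonneg_left (norm_leftSum_le b.basis hLE a) hK.pos.le)

/-- The sum of the coefficients. -/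
noncomputable def coeffSum : (ℕ →₀ ℝ) →ₗ[ℝ] ℝ := Finsupp.linearCombination ℝ fun _ => (1 : ℝ)

theorem coeffSum_single (j : ℕ) (t : ℝ) : coeffSum (Finsupp.single j t) = t := by
  simp [coeffSum]

theorem leftSum_const (e : ℕ → E) (q : ℕ) (a : ℕ →₀ ℝ) :
    leftSum e (fun _ => q) a = coeffSum a • e q := by
  simp [leftSum, coeffSum, Finsupp.linearCombination_apply, Finsupp.sum, Finset.sum_smul]

theorem leftSum_congr (e : ℕ → E) {l l' : ℕ → ℕ} (a : ℕ →₀ ℝ) (h : ∀ j, a j ≠ 0 → l j = l' j) :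
    leftSum e l a = leftSum e l' a := by
  rw [leftSum_eq_sum e l subset_rfl, leftSum_eq_sum e l' subset_rfl]
  exact Finset.sum_congr rfl fun j hj => by rw [h j (Finsupp.mem_support_iff.1 hj)]

theorem abs_coeffSum_le (hb : ∀ i, ‖b i‖ = 1) (a : ℕ →₀ ℝ) :
    |coeffSum a| ≤ jamesNorm b.basis a := by
  have := norm_leftSum_le b.basis isLeftEnd_zero a
  rwa [leftSum_const, norm_smul, hb, mul_one] at this

theorem SuppressionBound.abs_apply_le (hK : SuppressionBound b K) (hb : ∀ i, ‖b i‖ = 1)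
    (a : ℕ →₀ ℝ) (j : ℕ) : |a j| ≤ K * jamesNorm b.basis a := by
  have h1 := norm_leftSum_le b.basis isLeftEnd_id a
  have h2 := hK.abs_coord_le hb j (leftSum b.basis id a)
  have h3 : b.coord j (leftSum b.basis id a) = a j := by
    rw [coord_leftSum]
    simp [Finsupp.sum]
    exact fun h => h.symm
  rw [h3] at h2
  exact h2.trans (mul_le_mul_of_nonneg_left h1 hK.pos.le)

theorem SuppressionBound.jamesNorm_single_le (hK : SuppressionBound b K) (hb : ∀ i, ‖b i‖ = 1)
    (j : ℕ) (t : ℝ) : jamesNorm b.basis (Finsupp.single j t) ≤ K * |t| := by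
  refine hK.jamesNorm_le fun l _ => ?_
  rw [leftSum_single, norm_smul, hb, mul_one, Real.norm_eq_abs]

end LeftEnd

section BlockEstimates

variable {E : Type*} [NormedAddCommGroup E] [NormedSpace ℝ E]
variable {b : SchauderBasis ℝ E} {K : ℝ}

theorem UpperEstimate.exists_range {p : ℝ} (h : UpperEstimate b p) :
    ∃ M : ℝ, 0 ≤ M ∧ ∀ (n : ℕ) (x : ℕ → E),
      (∀ i j, i ≠ j → ∀ k, b.coord k (x i) = 0 ∨ b.coord k (x j) = 0) →
        ‖∑ i ∈ Finset.range n, x i‖ ≤ M * (∑ i ∈ Finset.range n, ‖x i‖ ^ p) ^ (1 / p) := by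
  obtain ⟨M, hM⟩ := h
  refine ⟨|M|, abs_nonneg M, fun n x hx => ?_⟩
  have := hM n (fun i => x i) fun i j hij k => hx i j (fun h => hij (Fin.ext h)) k
  rw [Fin.sum_univ_eq_sum_range (fun i => x i), Fin.sum_univ_eq_sum_range (fun i => ‖x i‖ ^ p)]
    at this
  exact this.trans (mul_le_mul_of_nonneg_right (le_abs_self M) (by positivity))

theorem rpow_sum_rpow_le {p : ℝ} (hp : 0 < p) {c : ℝ} (hc : 0 ≤ c) {x y : ℕ → ℝ}
    (hx : ∀ i, 0 ≤ x i) (hxy : ∀ i, x i ≤ c * y i) (hy : ∀ i, 0 ≤ y i) (F : Finset ℕ) :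
    (∑ i ∈ F, x i ^ p) ^ (1 / p) ≤ c * (∑ i ∈ F, y i ^ p) ^ (1 / p) := by
  have h1 : ∑ i ∈ F, x i ^ p ≤ c ^ p * ∑ i ∈ F, y i ^ p := by
    rw [Finset.mul_sum]
    refine Finset.sum_le_sum fun i _ => ?_
    rw [← Real.mul_rpow hc (hy i)]
    exact Real.rpow_le_rpow (hx i) (hxy i) hp.le
  have h0 : 0 ≤ ∑ i ∈ F, y i ^ p := Finset.sum_nonneg fun i _ => Real.rpow_nonneg (hy i) p
  calc _ ≤ (c ^ p * ∑ i ∈ F, y i ^ p) ^ (1 / p) :=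
        Real.rpow_le_rpow (Finset.sum_nonneg fun i _ => Real.rpow_nonneg (hx i) p) h1
          (by positivity)
    _ = c * (∑ i ∈ F, y i ^ p) ^ (1 / p) := by
        rw [Real.mul_rpow (Real.rpow_nonneg hc p) h0, ← Real.rpow_mul hc,
          mul_one_div_cancel hp.ne', Real.rpow_one]

/-- Successive blocks with vanishing coefficient sums satisfy an upper `p`-estimate in the James
norm. -/
theorem SuppressionBound.exists_jamesNorm_sum_blocks_le (hK : SuppressionBound b K)
    (hb : ∀ i, ‖b i‖ = 1) {p : ℝ} (hp : 0 < p) (hupper : UpperEstimate b p) :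
    ∃ C : ℝ, 0 ≤ C ∧ ∀ (s : ℕ → ℕ) (v : ℕ → ℕ →₀ ℝ), StrictMono s →
      (∀ i j, v i j ≠ 0 → s i ≤ j ∧ j < s (i + 1)) → (∀ i, coeffSum (v i) = 0) → ∀ n,
        jamesNorm b.basis (∑ i ∈ Finset.range n, v i) ≤
          C * (∑ i ∈ Finset.range n, jamesNorm b.basis (v i) ^ p) ^ (1 / p) := by
  obtain ⟨M, hM0, hM⟩ := hupper.exists_range
  have hK0 := hK.pos
  refine ⟨K * (M * (K + (1 + K))), by positivity, fun s v hs hv hv0 n => ?_⟩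
  rw [mul_assoc]
  refine hK.jamesNorm_le fun l hl => ?_
  set N : ℕ → ℝ := fun i => jamesNorm b.basis (v i) with hN
  have hN0 : ∀ i, 0 ≤ N i := fun i => jamesNorm_nonneg _ _
  set α : ℕ → ℝ := fun i => b.coord (l (s i)) (leftSum b.basis l (v i)) with hα
  set A : ℕ → E := fun i => α i • b (l (s i)) with hA
  set w : ℕ → E := fun i => leftSum b.basis l (v i) - A i with hw
  have hαN : ∀ i, |α i| ≤ K * N i := fun i => (hK.abs_coord_le hb _ _).trans
    (mul_le_mul_of_nonneg_left (norm_leftSum_le _ hl _) hK0.le)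
  have hAN : ∀ i, ‖A i‖ ≤ K * N i := fun i => by
    rw [hA, norm_smul, hb, mul_one]; exact hαN i
  have hwN : ∀ i, ‖w i‖ ≤ (1 + K) * N i := fun i => by
    refine (norm_sub_le _ _).trans ?_
    rw [add_mul, one_mul]
    exact add_le_add (norm_leftSum_le _ hl _) (hAN i)
  have hAlt : ∀ i j, i < j → l (s i) = l (s j) → α i = 0 := by
    intro i j hij hl'
    have : leftSum b.basis l (v i) = leftSum b.basis (fun _ => l (s j)) (v i) := by
      refine leftSum_congr _ _ fun m hm => ?_
      have h1 := hv i m hm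
      refine hl.eq_of_le m (s j) ?_ (h1.2.le.trans (hs.monotone hij))
      rw [← hl']
      exact (hl.le_self _).trans h1.1
    simp only [hα, this, leftSum_const, hv0, zero_smul, map_zero]
  have hAdisj : ∀ i j, i ≠ j → ∀ k, b.coord k (A i) = 0 ∨ b.coord k (A j) = 0 := by
    intro i j hij k
    by_contra hcon
    push Not at hcon
    have hk : ∀ i, b.coord k (A i) ≠ 0 → k = l (s i) ∧ α i ≠ 0 := by
      intro i h
      simp only [hA, map_smul, coord_basis, smul_eq_mul] at h
      refine ⟨by_contra fun h' => h (by simp [h']), left_ne_zero_of_mul h⟩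
    obtain ⟨h1, h2⟩ := hk i hcon.1
    obtain ⟨h3, h4⟩ := hk j hcon.2
    rcases lt_or_gt_of_ne hij with h | h
    · exact h2 (hAlt i j h (h1.symm.trans h3))
    · exact h4 (hAlt j i h (h3.symm.trans h1))
  have hwblock : ∀ i k, b.coord k (w i) ≠ 0 → s i ≤ k ∧ k < s (i + 1) := by
    intro i k h
    have hne : k ≠ l (s i) := by
      rintro rfl
      apply h
      simp [hw, hA, coord_basis, hα]
    have h1 : b.coord k (leftSum b.basis l (v i)) ≠ 0 := by
      simpa [hw, hA, coord_basis, hne] using h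
    obtain ⟨j, hj, hjk⟩ : ∃ j, v i j ≠ 0 ∧ l j = k := by
      by_contra hcon
      push Not at hcon
      exact h1 (coord_leftSum_eq_zero hcon)
    have h2 := hv i j hj
    refine ⟨?_, (hjk ▸ hl.le_self j).trans_lt h2.2⟩
    by_contra hlt
    push Not at hlt
    exact hne ((hl.eq_of_le (s i) j (by omega) h2.1).trans hjk).symm
  have hwdisj : ∀ i j, i ≠ j → ∀ k, b.coord k (w i) = 0 ∨ b.coord k (w j) = 0 := by
    intro i j hij k
    by_contra hcon
    push Not at hcon
    have h1 := hwblock i k hcon.1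
    have h2 := hwblock j k hcon.2
    exact hij ((blockIndex_eq hs h1.1 h1.2).symm.trans (blockIndex_eq hs h2.1 h2.2))
  have hsum : leftSum b.basis l (∑ i ∈ Finset.range n, v i) =
      ∑ i ∈ Finset.range n, A i + ∑ i ∈ Finset.range n, w i := by
    rw [map_sum, ← Finset.sum_add_distrib]
    exact Finset.sum_congr rfl fun i _ => by simp [hw]
  rw [hsum]
  have h1 := (hM n A hAdisj).trans (mul_le_mul_of_nonneg_left
    (rpow_sum_rpow_le hp hK0.le (fun i => norm_nonneg (A i)) hAN hN0 _) hM0)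
  have h2 := (hM n w hwdisj).trans (mul_le_mul_of_nonneg_left
    (rpow_sum_rpow_le hp (by positivity) (fun i => norm_nonneg (w i)) hwN hN0 _) hM0)
  refine (norm_add_le _ _).trans ((add_le_add h1 h2).trans (le_of_eq ?_))
  ring

/-- Differences of successive pairs of the unit vectors are dominated by the basis. -/
theorem SuppressionBound.exists_jamesNorm_sum_sub_le (hK : SuppressionBound b K)
    (hb : ∀ i, ‖b i‖ = 1)
    (hsub : ∀ n : ℕ → ℕ, StrictMono n → SeqEquivalent (fun i => b (n i)) (fun i => b i)) :
    ∃ C : ℝ, 0 ≤ C ∧ ∀ (k : ℕ → ℕ), StrictMono k → ∀ (F : Finset ℕ) (t : ℕ → ℝ),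
      jamesNorm b.basis (∑ i ∈ F, t i • (Finsupp.single (k (2 * i)) (1 : ℝ) -
        Finsupp.single (k (2 * i + 1)) 1)) ≤ C * ‖∑ i ∈ F, t i • b i‖ := by
  classical
  obtain ⟨C, hC0, hC⟩ := hK.exists_uniform_equivalence hb hsub
  have hK0 := hK.pos
  refine ⟨K * (C * K + C * K), by positivity, fun k hk F t => ?_⟩
  rw [mul_assoc]
  refine hK.jamesNorm_le fun l hl => ?_
  set I := F.filter fun i => l (k (2 * i)) ≠ l (k (2 * i + 1)) with hI
  have hIF : I ⊆ F := Finset.filter_subset _ _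
  have hlt : ∀ i ∈ I, l (k (2 * i)) < l (k (2 * i + 1)) := fun i hi =>
    lt_of_le_of_ne (hl.monotone (hk.monotone (Nat.le_succ _))) (Finset.mem_filter.1 hi).2
  have hle : ∀ i j, i < j → l (k (2 * i + 1)) ≤ l (k (2 * j)) := fun i j hij =>
    hl.monotone (hk.monotone (by omega))
  have h1 : StrictMonoOn (fun i => l (k (2 * i))) I := fun i hi j _ hij =>
    (hlt i hi).trans_le (hle i j hij)
  have h2 : StrictMonoOn (fun i => l (k (2 * i + 1))) I := fun i _ j hj hij =>
    (hle i j hij).trans_lt (hlt j hj)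
  have hsum : leftSum b.basis l (∑ i ∈ F, t i • (Finsupp.single (k (2 * i)) (1 : ℝ) -
        Finsupp.single (k (2 * i + 1)) 1)) =
      ∑ i ∈ I, t i • b (l (k (2 * i))) - ∑ i ∈ I, t i • b (l (k (2 * i + 1))) := by
    rw [← Finset.sum_sub_distrib, map_sum]
    refine (Finset.sum_subset hIF fun i hi hi' => ?_).symm.trans ?_
    · have : l (k (2 * i)) = l (k (2 * i + 1)) := by
        by_contra h
        exact hi' (Finset.mem_filter.2 ⟨hi, h⟩)
      simp [leftSum_single, this]
    · exact Finset.sum_congr rfl fun i _ => by simp [leftSum_single, smul_sub]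
  rw [hsum]
  have h3 : ‖∑ i ∈ I, t i • b i‖ ≤ K * ‖∑ i ∈ F, t i • b i‖ :=
    hK.norm_sum_subset_le (l := id) hIF (Set.injOn_id _) t
  have h4 := mul_le_mul_of_nonneg_left h3 hC0
  have h5 := hC I _ id t h1 (strictMono_id.strictMonoOn _)
  have h6 := hC I _ id t h2 (strictMono_id.strictMonoOn _)
  refine (norm_sub_le _ _).trans ((add_le_add (h5.trans h4) (h6.trans h4)).trans (le_of_eq ?_))
  ring

/-- Sums over successive intervals, as functionals, are dominated by the coordinate functionals. -/
theorem SuppressionBound.exists_abs_sum_intervals_le (hK : SuppressionBound b K)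
    (hb : ∀ i, ‖b i‖ = 1)
    (hsub : ∀ n : ℕ → ℕ, StrictMono n → SeqEquivalent (fun i => b (n i)) (fun i => b i)) :
    ∃ C : ℝ, 0 ≤ C ∧ ∀ (n : ℕ → ℕ), StrictMono n → ∀ (F : Finset ℕ) (t : ℕ → ℝ) (a : ℕ →₀ ℝ),
      |∑ i ∈ F, t i * ∑ j ∈ Finset.Ico (n (2 * i)) (n (2 * i + 1)), a j| ≤
        C * ‖∑ i ∈ F, t i • b.coord i‖ * jamesNorm b.basis a := by
  classical
  obtain ⟨C, hC0, hC⟩ := hK.exists_uniform_equivalence hb hsub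
  have hK0 := hK.pos
  refine ⟨C * K, by positivity, fun n hn F t a => ?_⟩
  set l := glueLeftEnd n fun _ _ => 0 with hl
  have hle : IsLeftEnd l := isLeftEnd_glueLeftEnd hn fun _ => isLeftEnd_zero
  set y := leftSum b.basis l a with hy
  have hcoord : ∀ i, b.coord (n i) y = ∑ j ∈ Finset.Ico (n i) (n (i + 1)), a j := by
    intro i
    rw [hy, coord_leftSum, Finsupp.sum, ← Finset.sum_filter]
    refine Finset.sum_subset_zero_on_sdiff ?_ ?_ fun _ _ => rfl
    · intro j hj
      rw [Finset.mem_filter, glueLeftEnd_zero_eq_iff hn] at hj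
      exact Finset.mem_Ico.2 hj.2
    · intro j hj
      rw [Finset.mem_sdiff, Finset.mem_filter, glueLeftEnd_zero_eq_iff hn, Finset.mem_Ico] at hj
      by_contra h
      exact hj.2 ⟨Finsupp.mem_support_iff.2 h, hj.1⟩
  set c : ℕ → ℝ := fun i => b.coord (n (2 * i)) y with hc
  have hinj : StrictMono fun i => n (2 * i) := fun i j hij => hn (by omega)
  have h1 : ∑ i ∈ F, t i * ∑ j ∈ Finset.Ico (n (2 * i)) (n (2 * i + 1)), a j =
      (∑ i ∈ F, t i • b.coord i) (∑ i ∈ F, c i • b i) := by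
    simp only [sum_apply, smul_apply, smul_eq_mul]
    refine Finset.sum_congr rfl fun i hi => ?_
    have := coord_sum_of_injOn (b := b) (l := id) (Set.injOn_id (F : Set ℕ)) c hi
    simp only [id] at this
    rw [this, ← hcoord]
  have h2 : ‖∑ i ∈ F, c i • b i‖ ≤ C * K * jamesNorm b.basis a := by
    refine (hC F id _ c (strictMono_id.strictMonoOn _) (hinj.strictMonoOn _)).trans ?_
    rw [mul_assoc]
    refine mul_le_mul_of_nonneg_left ?_ hC0
    have := hK.2 (F.image fun i => n (2 * i)) y
    rw [Finset.sum_image hinj.injective.injOn] at this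
    exact this.trans (mul_le_mul_of_nonneg_left (norm_leftSum_le _ hle _) hK0.le)
  rw [h1, ← Real.norm_eq_abs]
  refine (ContinuousLinearMap.le_opNorm _ _).trans
    ((mul_le_mul_of_nonneg_left h2 (norm_nonneg _)).trans (le_of_eq ?_))
  ring

end BlockEstimates

section BoundedlyComplete

variable {E : Type*} [NormedAddCommGroup E] [NormedSpace ℝ E]
variable {b : SchauderBasis ℝ E} {K : ℝ}

theorem leftSum_eq_add_of_max (b : SchauderBasis ℝ E) {l L : ℕ → ℕ} (hl : IsLeftEnd l) {s : ℕ}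
    {a : ℕ →₀ ℝ} (ha : ∀ j, a j ≠ 0 → s ≤ j) (hL : ∀ j, a j ≠ 0 → L j = max s (l j)) :
    leftSum b l a = leftSum b L a + b.coord s (leftSum b L a) • (b (l s) - b s) := by
  rw [coord_leftSum, Finsupp.sum, leftSum_eq_sum b.basis l subset_rfl,
    leftSum_eq_sum b.basis L subset_rfl, Finset.sum_smul, ← Finset.sum_add_distrib]
  refine Finset.sum_congr rfl fun j hj => ?_
  have hj' := Finsupp.mem_support_iff.1 hj
  rw [hL j hj']
  by_cases h : l j ≤ s
  · rw [max_eq_left h, if_pos rfl, hl.eq_of_le s j h (ha j hj'), smul_sub]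
    abel
  · push Not at h
    rw [max_eq_right h.le, if_neg h.ne']
    simp

theorem SuppressionBound.norm_leftSum_le_of_max (hK : SuppressionBound b K)
    (hb : ∀ i, ‖b i‖ = 1) {l L : ℕ → ℕ} (hl : IsLeftEnd l) {s : ℕ}
    {a : ℕ →₀ ℝ} (ha : ∀ j, a j ≠ 0 → s ≤ j) (hL : ∀ j, a j ≠ 0 → L j = max s (l j)) :
    ‖leftSum b l a‖ ≤ (1 + 2 * K) * ‖leftSum b L a‖ := by
  rw [leftSum_eq_add_of_max b hl ha hL]
  have h1 : ‖b (l s) - b s‖ ≤ 2 := by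
    refine (norm_sub_le _ _).trans ?_
    rw [hb, hb]; norm_num
  have h2 := hK.abs_coord_le hb s (leftSum b L a)
  refine (norm_add_le _ _).trans ?_
  rw [norm_smul, Real.norm_eq_abs]
  have h3 := mul_le_mul h2 h1 (norm_nonneg _) (mul_nonneg hK.pos.le (norm_nonneg _))
  linarith

/-- The finite segment of a sequence of coefficients. -/
noncomputable def coeffSegment (a : ℕ → ℝ) (m n : ℕ) : ℕ →₀ ℝ :=
  ∑ i ∈ Finset.Ico m n, Finsupp.single i (a i)

theorem coeffSegment_apply (a : ℕ → ℝ) (m n j : ℕ) :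
    coeffSegment a m n j = if m ≤ j ∧ j < n then a j else 0 := by
  rw [coeffSegment, Finsupp.finsetSum_apply]
  simp [Finsupp.single_apply]

theorem coeffSegment_sub (a : ℕ → ℝ) {m n : ℕ} (h : m ≤ n) :
    coeffSegment a 0 n - coeffSegment a 0 m = coeffSegment a m n := by
  rw [sub_eq_iff_eq_add', coeffSegment, coeffSegment, coeffSegment,
    Finset.sum_Ico_consecutive _ (Nat.zero_le m) h]

/-- The sequence of unit vectors of the James type space is boundedly complete. -/
theorem SuppressionBound.exists_forall_jamesNorm_coeffSegment_lt (hK : SuppressionBound b K)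
    (hb : ∀ i, ‖b i‖ = 1) (hE : IsReflexiveSpace E) {a : ℕ → ℝ} {Λ : ℝ}
    (ha : ∀ n, jamesNorm b.basis (coeffSegment a 0 n) ≤ Λ) {ε : ℝ} (hε : 0 < ε) :
    ∃ N, ∀ n ≥ N, jamesNorm b.basis (coeffSegment a N n) < ε := by
  have hK0 := hK.pos
  by_contra hcon
  push Not at hcon
  choose ν hν1 hν2 using hcon
  have hν : ∀ N, N < ν N := by
    intro N
    refine lt_of_le_of_ne (hν1 N) fun h => ?_
    have := hν2 N
    rw [← h] at this
    have h0 : coeffSegment a N N = 0 := by simp [coeffSegment]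
    have h00 : jamesNorm b.basis 0 = 0 := by simpa using jamesNorm_smul b.basis 0 0
    rw [h0, h00] at this
    linarith
  set s : ℕ → ℕ := fun i => ν^[i] 0 with hs
  have hsucc : ∀ i, s (i + 1) = ν (s i) := fun i => Function.iterate_succ_apply' ν i 0
  have hs0 : s 0 = 0 := rfl
  have hsm : StrictMono s := strictMono_nat_of_lt_succ fun i => hsucc i ▸ hν (s i)
  set x : ℕ → ℕ →₀ ℝ := fun i => coeffSegment a (s i) (s (i + 1)) with hx
  have hxsupp : ∀ i j, x i j ≠ 0 → s i ≤ j ∧ j < s (i + 1) := by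
    intro i j h
    rw [hx, coeffSegment_apply] at h
    by_contra h'
    exact h (if_neg h')
  have hex : ∀ i, ∃ l, IsLeftEnd l ∧ ε / (2 * K) < ‖leftSum b.basis l (x i)‖ := by
    intro i
    by_contra hcon
    push Not at hcon
    have h1 := hK.jamesNorm_le hcon
    have h2 : ε ≤ jamesNorm b.basis (x i) := by
      simp only [hx, hsucc]
      exact hν2 (s i)
    have h3 : K * (ε / (2 * K)) = ε / 2 := by field_simp
    linarith
  choose l hl hlx using hex
  set L := glueLeftEnd s l with hL
  have hLE : IsLeftEnd L := isLeftEnd_glueLeftEnd hsm hl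
  set y : ℕ → E := fun n => leftSum b.basis L (coeffSegment a 0 n) with hy
  have hyΛ : ∀ n, ‖y n‖ ≤ Λ := fun n => (norm_leftSum_le _ hLE _).trans (ha n)
  have hstable : ∀ k m m', m ≤ m' → k < s m → b.coord k (y (s m')) = b.coord k (y (s m)) := by
    intro k m m' hmm hk
    rw [← sub_eq_zero, ← map_sub, hy, ← map_sub, coeffSegment_sub a (hsm.monotone hmm)]
    refine coord_leftSum_eq_zero fun j hj => ?_
    rw [coeffSegment_apply] at hj
    have hj' : s m ≤ j := by
      by_contra h'
      exact hj (if_neg fun h => h' h.1)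
    have h1 : L (s m) = s m := by
      rw [hL, glueLeftEnd_eq hsm l le_rfl (hsm (Nat.lt_succ_self m)),
        max_eq_left ((hl m).le_self _)]
    have := hLE.monotone hj'
    omega
  set c : ℕ → ℝ := fun k => b.coord k (y (s (k + 1))) with hc
  have hyc : ∀ k m, k < s m → b.coord k (y (s m)) = c k := by
    intro k m hk
    have hk' : k < s (k + 1) := hsm.id_le (k + 1)
    rcases le_total m (k + 1) with h | h
    · exact (hstable k m (k + 1) h hk).symm
    · exact hstable k (k + 1) m h hk'
  have hbd : ∀ n, ‖∑ i ∈ Finset.range n, c i • b i‖ ≤ K * Λ := by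
    intro n
    have h1 : ∑ i ∈ Finset.range n, c i • b i =
        ∑ i ∈ Finset.range n, b.coord i (y (s n)) • b i :=
      Finset.sum_congr rfl fun i hi => by
        rw [hyc i n ((Finset.mem_range.1 hi).trans_le (hsm.id_le n))]
    rw [h1]
    exact (hK.2 _ _).trans (mul_le_mul_of_nonneg_left (hyΛ _) hK0.le)
  obtain ⟨z, hz⟩ := hE.exists_tendsto_sum b hbd
  have hys : ∀ m, y (s m) = ∑ i ∈ Finset.range (s m), c i • b i := by
    intro m
    have h1 : ∑ i ∈ Finset.range (s m), c i • b i =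
        ∑ i ∈ Finset.range (s m), b.coord i (y (s m)) • b i :=
      Finset.sum_congr rfl fun i hi => by rw [hyc i m (Finset.mem_range.1 hi)]
    rw [h1, hy, sum_coord_leftSum, Finsupp.filter_eq_self_iff _ _ |>.2]
    intro j hj
    rw [coeffSegment_apply] at hj
    have hj' : j < s m := by
      by_contra h'
      exact hj (if_neg fun h => h' h.2)
    exact (hLE.le_self j).trans_lt hj'
  have hylim : Tendsto (fun m => y (s m)) atTop (𝓝 z) := by
    simp only [hys]
    exact hz.comp hsm.tendsto_atTop
  have hdiff : Tendsto (fun m => ‖y (s (m + 1)) - y (s m)‖) atTop (𝓝 0) := by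
    have := ((hylim.comp (tendsto_add_atTop_nat 1)).sub hylim).norm
    simpa using this
  have hlow : ∀ m, ε / (2 * K) / (1 + 2 * K) ≤ ‖y (s (m + 1)) - y (s m)‖ := by
    intro m
    rw [hy, ← map_sub, coeffSegment_sub a (hsm.monotone (Nat.le_succ m)), div_le_iff₀' (by positivity)]
    refine (hlx m).le.trans (hK.norm_leftSum_le_of_max hb (hl m) (fun j hj => (hxsupp m j hj).1)
      fun j hj => ?_)
    exact glueLeftEnd_eq hsm l (hxsupp m j hj).1 (hxsupp m j hj).2
  have := ge_of_tendsto' hdiff hlow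
  have h0 : 0 < ε / (2 * K) / (1 + 2 * K) := by positivity
  linarith

end BoundedlyComplete

section JamesSpaceFunctionals

variable {E : Type*} [NormedAddCommGroup E] [NormedSpace ℝ E]

/-- The inclusion of the finitely non-zero sequences into the James type space. -/
noncomputable def toJames (e : ℕ → E) : (ℕ →₀ ℝ) →ₗ[ℝ] JamesSpace e :=
  (UniformSpace.Completion.toComplₗᵢ (𝕜 := ℝ) (E := PreJames e)).toLinearMap

theorem norm_toJames (e : ℕ → E) (a : ℕ →₀ ℝ) : ‖toJames e a‖ = jamesNorm e a :=
  UniformSpace.Completion.norm_coe (E := PreJames e) a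

theorem denseRange_toJames (e : ℕ → E) : DenseRange (toJames e) :=
  UniformSpace.Completion.denseRange_coe (α := PreJames e)

theorem exists_functional (e : ℕ → E) (φ : (ℕ →₀ ℝ) →ₗ[ℝ] ℝ) {C : ℝ}
    (h : ∀ a, |φ a| ≤ C * jamesNorm e a) :
    ∃ f : StrongDual ℝ (JamesSpace e), ∀ a, f (toJames e a) = φ a := by
  let φ' : PreJames e →ₗ[ℝ] ℝ := φ
  let g : PreJames e →L[ℝ] ℝ := φ'.mkContinuous C h
  refine ⟨g.extend (UniformSpace.Completion.toComplL (𝕜 := ℝ) (E := PreJames e)), fun a => ?_⟩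
  exact ContinuousLinearMap.extend_eq g (UniformSpace.Completion.denseRange_coe)
    (UniformSpace.Completion.isUniformInducing_coe _) (a : PreJames e)

theorem norm_functional_le (e : ℕ → E) (f : StrongDual ℝ (JamesSpace e)) {C : ℝ} (hC : 0 ≤ C)
    (h : ∀ a, |f (toJames e a)| ≤ C * jamesNorm e a) : ‖f‖ ≤ C := by
  refine f.opNorm_le_bound hC fun x => ?_
  refine (denseRange_toJames e).induction_on (p := fun x => ‖f x‖ ≤ C * ‖x‖) x
    (isClosed_le (by fun_prop) (by fun_prop)) fun a => ?_
  rw [norm_toJames]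
  exact h a

end JamesSpaceFunctionals

section JamesDual

variable {E : Type*} [NormedAddCommGroup E] [NormedSpace ℝ E]
variable {b : SchauderBasis ℝ E} {K p : ℝ}

/-- The unit vectors `uⱼ` of the James type space. -/
noncomputable def jamesUnit (e : ℕ → E) (j : ℕ) : JamesSpace e := toJames e (Finsupp.single j 1)

/-- No functional is bounded below on blocks with vanishing coefficient sums which start
arbitrarily far out. -/
theorem SuppressionBound.exists_forall_lt_of_blocks (hK : SuppressionBound b K)
    (hb : ∀ i, ‖b i‖ = 1) (hp : 1 < p) (hupper : UpperEstimate b p)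
    (f : StrongDual ℝ (JamesSpace b.basis)) {δ D : ℝ} (hδ : 0 < δ) :
    ∃ N, ∀ v : ℕ →₀ ℝ, (∀ j, v j ≠ 0 → N ≤ j) → coeffSum v = 0 → jamesNorm b.basis v ≤ D →
      f (toJames b.basis v) < δ := by
  by_contra hcon
  push Not at hcon
  choose w hw1 hw2 hw3 hw4 using hcon
  obtain ⟨C, hC0, hC⟩ := hK.exists_jamesNorm_sum_blocks_le hb (zero_lt_one.trans hp) hupper
  have hD : 0 ≤ D := (jamesNorm_nonneg _ _).trans (hw3 0)
  set ν : ℕ → ℕ := fun N => max (N + 1) ((w N).support.sup id + 1) with hν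
  set s : ℕ → ℕ := fun i => ν^[i] 0 with hs
  have hsucc : ∀ i, s (i + 1) = ν (s i) := fun i => Function.iterate_succ_apply' ν i 0
  have hsm : StrictMono s := strictMono_nat_of_lt_succ fun i => by
    rw [hsucc]
    exact (Nat.lt_succ_self _).trans_le (le_max_left _ _)
  have hsupp : ∀ i j, w (s i) j ≠ 0 → s i ≤ j ∧ j < s (i + 1) := by
    intro i j hj
    refine ⟨hw1 (s i) j hj, ?_⟩
    rw [hsucc]
    refine lt_of_lt_of_le ?_ (le_max_right _ _)
    exact Nat.lt_succ_of_le (Finset.le_sup (f := id) (Finsupp.mem_support_iff.2 hj))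
  have hbound : ∀ n : ℕ, n * δ ≤ ‖f‖ * (C * (D * (n : ℝ) ^ (1 / p))) := by
    intro n
    have h1 : (n : ℝ) * δ ≤ f (toJames b.basis (∑ i ∈ Finset.range n, w (s i))) := by
      rw [map_sum, map_sum]
      have := Finset.card_nsmul_le_sum (Finset.range n) (fun i => f (toJames b.basis (w (s i)))) δ
        (fun i _ => hw4 (s i))
      simpa using this
    have h2 := hC s (fun i => w (s i)) hsm hsupp (fun i => hw2 (s i)) n
    have h3 := rpow_sum_rpow_le (zero_lt_one.trans hp) hD
      (x := fun i => jamesNorm b.basis (w (s i))) (y := fun _ => 1)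
      (fun i => jamesNorm_nonneg _ _) (fun i => by rw [mul_one]; exact hw3 (s i))
      (fun _ => zero_le_one) (Finset.range n)
    simp only [Real.one_rpow, Finset.sum_const, Finset.card_range, nsmul_eq_mul, mul_one] at h3
    refine h1.trans ((le_abs_self _).trans ((f.le_opNorm _).trans
      (mul_le_mul_of_nonneg_left ?_ (norm_nonneg f))))
    rw [norm_toJames]
    exact h2.trans (mul_le_mul_of_nonneg_left h3 hC0)
  have hq : 0 < 1 - 1 / p := by
    rw [sub_pos, div_lt_one (zero_lt_one.trans hp)]
    exact hp
  have hlim := (tendsto_rpow_atTop hq).comp (tendsto_natCast_atTop_atTop (R := ℝ))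
  obtain ⟨n, hn1, hn2⟩ := ((hlim.eventually_gt_atTop (‖f‖ * C * D / δ)).and
    (eventually_gt_atTop 0)).exists
  have hn : (0 : ℝ) < n := Nat.cast_pos.2 hn2
  have h1 := hbound n
  have h2 : (n : ℝ) = (n : ℝ) ^ (1 - 1 / p) * (n : ℝ) ^ (1 / p) := by
    rw [← Real.rpow_add hn, sub_add_cancel, Real.rpow_one]
  have h3 : (0 : ℝ) < (n : ℝ) ^ (1 / p) := Real.rpow_pos_of_pos hn _
  simp only [Function.comp] at hn1
  rw [div_lt_iff₀ hδ] at hn1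
  have h4 := mul_lt_mul_of_pos_right hn1 h3
  have h5 : (n : ℝ) ^ (1 - 1 / p) * δ * (n : ℝ) ^ (1 / p) = n * δ := by
    rw [mul_right_comm, ← h2]
  linarith

theorem SuppressionBound.weaklyCauchy_jamesUnit (hK : SuppressionBound b K)
    (hb : ∀ i, ‖b i‖ = 1) (hp : 1 < p) (hupper : UpperEstimate b p) :
    WeaklyCauchy (jamesUnit b.basis) := by
  intro f
  refine Metric.cauchySeq_iff'.2 fun ε hε => ?_
  obtain ⟨N, hN⟩ := hK.exists_forall_lt_of_blocks hb hp hupper f (D := 2 * K) hε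
  refine ⟨N, fun n hn => ?_⟩
  have key : ∀ i j, N ≤ i → N ≤ j → f (jamesUnit b.basis i) - f (jamesUnit b.basis j) < ε := by
    intro i j hi hj
    rw [← map_sub, jamesUnit, jamesUnit, ← map_sub]
    refine hN _ (fun m hm => ?_) (by simp [coeffSum_single]) ?_
    · by_contra h
      push Not at h
      exact hm (by simp [(h.trans_le hi).ne', (h.trans_le hj).ne'])
    · rw [← norm_toJames, map_sub]
      refine (norm_sub_le _ _).trans ?_
      rw [norm_toJames, norm_toJames]
      have h1 := hK.jamesNorm_single_le hb i 1
      have h2 := hK.jamesNorm_single_le hb j 1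
      rw [abs_one, mul_one] at h1 h2
      linarith
  rw [Real.dist_eq, abs_lt]
  exact ⟨by linarith [key N n le_rfl hn], key n N hn le_rfl⟩

theorem filter_lt_eq_sum (a : ℕ →₀ ℝ) (n : ℕ) :
    a.filter (· < n) = ∑ j ∈ Finset.range n, a j • Finsupp.single j (1 : ℝ) := by
  ext i
  rw [Finsupp.finsetSum_apply]
  by_cases h : i < n
  · simp [Finsupp.single_apply, h]
  · simp [Finsupp.single_apply, h]

theorem exists_jamesCoord (hK : SuppressionBound b K) (hb : ∀ i, ‖b i‖ = 1) :
    ∃ u' : ℕ → StrongDual ℝ (JamesSpace b.basis), ∀ i a, u' i (toJames b.basis a) = a i := by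
  have := fun i => exists_functional b.basis (Finsupp.lapply i)
    (fun a => hK.abs_apply_le hb a i)
  choose u' hu' using this
  exact ⟨u', hu'⟩

theorem exists_jamesSum (hb : ∀ i, ‖b i‖ = 1) :
    ∃ S : StrongDual ℝ (JamesSpace b.basis), ∀ a, S (toJames b.basis a) = coeffSum a :=
  exists_functional b.basis coeffSum (C := 1) fun a => by
    rw [one_mul]; exact abs_coeffSum_le hb a

variable {u' : ℕ → StrongDual ℝ (JamesSpace b.basis)}

/-- A functional which tends to zero along the unit vectors lies in the closed span of the
coordinate functionals. -/
theorem SuppressionBound.tendsto_sum_jamesCoord (hK : SuppressionBound b K)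
    (hb : ∀ i, ‖b i‖ = 1) (hp : 1 < p) (hupper : UpperEstimate b p)
    (hu' : ∀ i a, u' i (toJames b.basis a) = a i) {g : StrongDual ℝ (JamesSpace b.basis)}
    (hg : Tendsto (fun n => g (jamesUnit b.basis n)) atTop (𝓝 0)) :
    Tendsto (fun n => ∑ j ∈ Finset.range n, g (jamesUnit b.basis j) • u' j) atTop (𝓝 g) := by
  have hK0 := hK.pos
  refine Metric.tendsto_atTop.2 fun ε hε => ?_
  set R : ℝ := 1 + K * K with hR
  have hR0 : 0 < R := by positivity
  obtain ⟨N, hN⟩ := hK.exists_forall_lt_of_blocks hb hp hupper g (D := R + R * K)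
    (δ := ε / 4) (by positivity)
  obtain ⟨k, hkN, hk⟩ : ∃ k, N ≤ k ∧ |g (jamesUnit b.basis k)| ≤ ε / 4 / R := by
    have h1 := hg.abs
    rw [abs_zero] at h1
    obtain ⟨k, h2, h3⟩ := ((eventually_ge_atTop N).and
      (h1.eventually (gt_mem_nhds (show 0 < ε / 4 / R by positivity)))).exists
    exact ⟨k, h2, h3.le⟩
  refine ⟨N, fun n hn => ?_⟩
  rw [dist_comm, dist_eq_norm]
  refine lt_of_le_of_lt (norm_functional_le b.basis _ (C := ε / 2) (by positivity) fun a => ?_)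
    (half_lt_self hε)
  set v := a - a.filter (· < n) with hv
  have hva : (g - ∑ j ∈ Finset.range n, g (jamesUnit b.basis j) • u' j) (toJames b.basis a) =
      g (toJames b.basis v) := by
    rw [hv, filter_lt_eq_sum, map_sub, map_sub, map_sum, map_sum, sub_apply, sum_apply]
    congr 1
    refine Finset.sum_congr rfl fun j _ => ?_
    rw [map_smul, map_smul, smul_apply, hu', smul_eq_mul, smul_eq_mul, mul_comm, jamesUnit]
  have hvsupp : ∀ j, v j ≠ 0 → N ≤ j := by
    intro j hj
    by_contra h
    push Not at h
    exact hj (by simp [hv, h.trans_le hn])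
  set A := jamesNorm b.basis a with hA
  have hA0 : 0 ≤ A := jamesNorm_nonneg _ _
  have hvn : jamesNorm b.basis v ≤ R * A := by
    rw [← norm_toJames, hv, map_sub]
    refine (norm_sub_le _ _).trans ?_
    rw [norm_toJames, norm_toJames]
    have := hK.jamesNorm_filter_lt_le a n
    rw [hR]
    linarith
  rw [hva]
  rcases hA0.eq_or_lt with h0 | hpos
  · have h1 : ‖toJames b.basis v‖ ≤ 0 := by
      rw [norm_toJames]
      refine hvn.trans (by rw [← h0, mul_zero])
    have h2 := g.le_opNorm (toJames b.basis v)
    rw [Real.norm_eq_abs] at h2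
    refine h2.trans ?_
    rw [← h0, mul_zero]
    exact mul_nonpos_of_nonneg_of_nonpos (norm_nonneg g) h1
  have key : ∀ θ : ℝ, |θ| = 1 → θ * g (toJames b.basis v) ≤ ε / 2 * A := by
    intro θ hθ
    set c : ℝ := θ / A with hc
    have hcA : |c| * A = 1 := by
      rw [hc, abs_div, hθ, abs_of_pos hpos]
      field_simp
    set v' := c • (v - Finsupp.single k (coeffSum v)) with hv'
    have hS : |coeffSum v| ≤ R * A := (abs_coeffSum_le hb v).trans hvn
    have h1 : g (toJames b.basis v') < ε / 4 := by
      refine hN v' (fun j hj => ?_) ?_ ?_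
      · by_contra h
        push Not at h
        have h2 : v j = 0 := by
          by_contra h3
          exact absurd (hvsupp j h3) (by omega)
        exact hj (by simp [hv', h2, (h.trans_le hkN).ne'])
      · simp [hv', coeffSum_single]
      · rw [hv', jamesNorm_smul, Real.norm_eq_abs]
        have h2 : jamesNorm b.basis (v - Finsupp.single k (coeffSum v)) ≤ R * A + K * (R * A) := by
          rw [← norm_toJames, map_sub]
          refine (norm_sub_le _ _).trans ?_
          rw [norm_toJames, norm_toJames]
          exact add_le_add hvn ((hK.jamesNorm_single_le hb k _).trans
            (mul_le_mul_of_nonneg_left hS hK0.le))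
        refine (mul_le_mul_of_nonneg_left h2 (abs_nonneg c)).trans (le_of_eq ?_)
        calc |c| * (R * A + K * (R * A)) = (|c| * A) * (R + R * K) := by ring
          _ = R + R * K := by rw [hcA, one_mul]
    have h2 : g (toJames b.basis v') =
        c * (g (toJames b.basis v) - coeffSum v * g (jamesUnit b.basis k)) := by
      rw [hv', jamesUnit, ← Finsupp.smul_single_one, map_smul, map_sub, map_smul, map_smul, map_sub,
        map_smul, smul_eq_mul, smul_eq_mul]
    have h3 : |coeffSum v * g (jamesUnit b.basis k)| ≤ ε / 4 * A := by
      rw [abs_mul]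
      refine (mul_le_mul hS hk (abs_nonneg _) (by positivity)).trans (le_of_eq ?_)
      field_simp
    have h4 : θ * (g (toJames b.basis v) - coeffSum v * g (jamesUnit b.basis k)) ≤ ε / 4 * A := by
      have h5 : θ * (g (toJames b.basis v) - coeffSum v * g (jamesUnit b.basis k)) =
          g (toJames b.basis v') * A := by
        rw [h2, hc]; field_simp
      rw [h5]
      exact mul_le_mul_of_nonneg_right h1.le hA0
    have h6 : θ * (coeffSum v * g (jamesUnit b.basis k)) ≤ ε / 4 * A := by
      refine (le_abs_self _).trans ?_
      rw [abs_mul, hθ, one_mul]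
      exact h3
    linarith
  rw [abs_le]
  have h1 := key 1 (by simp)
  have h2 := key (-1) (by simp)
  constructor <;> linarith

/-- The bidual of the James type space is spanned by the space and the weak* limit of the unit
vectors. -/
theorem SuppressionBound.bidualSpannedBy_jamesUnit (hK : SuppressionBound b K)
    (hb : ∀ i, ‖b i‖ = 1) (hp : 1 < p) (hupper : UpperEstimate b p) (hE : IsReflexiveSpace E) :
    BidualSpannedBy (jamesUnit b.basis) := by
  have hK0 := hK.pos
  obtain ⟨u', hu'⟩ := exists_jamesCoord hK hb
  obtain ⟨S, hS⟩ := exists_jamesSum hb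
  intro φ
  set a : ℕ → ℝ := fun j => φ (u' j) with ha
  have hseg : ∀ m n, toJames b.basis (coeffSegment a m n) =
      ∑ j ∈ Finset.Ico m n, a j • jamesUnit b.basis j := by
    intro m n
    rw [coeffSegment, map_sum]
    refine Finset.sum_congr rfl fun j _ => ?_
    rw [jamesUnit, ← map_smul, Finsupp.smul_single_one]
  have hφsum : ∀ (g : StrongDual ℝ (JamesSpace b.basis)) n,
      φ (∑ j ∈ Finset.range n, g (jamesUnit b.basis j) • u' j) =
        g (∑ j ∈ Finset.range n, a j • jamesUnit b.basis j) := by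
    intro g n
    simp [ha, mul_comm]
  have hbd : ∀ n, jamesNorm b.basis (coeffSegment a 0 n) ≤ ‖φ‖ * (K * K) := by
    intro n
    rw [← norm_toJames]
    obtain ⟨g, hg, hgx⟩ := exists_dual_vector'' ℝ (toJames b.basis (coeffSegment a 0 n))
    rw [hseg, ← Finset.range_eq_Ico] at hgx ⊢
    have h1 : ‖∑ j ∈ Finset.range n, a j • jamesUnit b.basis j‖ =
        φ (∑ j ∈ Finset.range n, g (jamesUnit b.basis j) • u' j) := by
      rw [hφsum, hgx]; rfl
    rw [h1]
    refine (le_abs_self _).trans ((φ.le_opNorm _).trans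
      (mul_le_mul_of_nonneg_left ?_ (norm_nonneg φ)))
    refine norm_functional_le b.basis _ (by positivity) fun x => ?_
    have h2 : (∑ j ∈ Finset.range n, g (jamesUnit b.basis j) • u' j) (toJames b.basis x) =
        g (toJames b.basis (x.filter (· < n))) := by
      rw [filter_lt_eq_sum, map_sum, map_sum, sum_apply]
      refine Finset.sum_congr rfl fun j _ => ?_
      rw [map_smul, map_smul, smul_apply, hu', smul_eq_mul, smul_eq_mul, mul_comm, jamesUnit]
    rw [h2]
    refine (g.le_of_opNorm_le hg _).trans ?_
    rw [one_mul, norm_toJames, mul_assoc]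
    exact hK.jamesNorm_filter_lt_le x n
  have hcau : CauchySeq fun n => ∑ j ∈ Finset.range n, a j • jamesUnit b.basis j := by
    refine Metric.cauchySeq_iff'.2 fun ε hε => ?_
    obtain ⟨N, hN⟩ := hK.exists_forall_jamesNorm_coeffSegment_lt hb hE hbd hε
    refine ⟨N, fun n hn => ?_⟩
    rw [dist_eq_norm, Finset.range_eq_Ico, Finset.range_eq_Ico, ← hseg, ← hseg, ← map_sub,
      coeffSegment_sub a hn, norm_toJames]
    exact hN n hn
  obtain ⟨x, hx⟩ := cauchySeq_tendsto_of_complete hcau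
  refine ⟨x, φ S - S x, fun f => ?_⟩
  obtain ⟨t, ht⟩ := cauchySeq_tendsto_of_complete (hK.weaklyCauchy_jamesUnit hb hp hupper f)
  set g := f - t • S with hg
  have hgu : Tendsto (fun n => g (jamesUnit b.basis n)) atTop (𝓝 0) := by
    have h1 : ∀ n, g (jamesUnit b.basis n) = f (jamesUnit b.basis n) - t := by
      intro n
      have h2 : S (jamesUnit b.basis n) = 1 := by rw [jamesUnit, hS, coeffSum_single]
      simp [hg, h2]
    simp only [h1]
    simpa using ht.sub_const t
  have h1 := (φ.continuous.tendsto g).comp (hK.tendsto_sum_jamesCoord hb hp hupper hu' hgu)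
  have h2 := (g.continuous.tendsto x).comp hx
  have h3 : φ g = g x := by
    refine tendsto_nhds_unique h1 (h2.congr fun n => ?_)
    exact (hφsum g n).symm
  have h4 : φ f = f x + (φ S - S x) * t := by
    simp only [hg, map_sub, map_smul, sub_apply, smul_apply, smul_eq_mul] at h3
    linarith
  rw [h4]
  exact (ht.const_mul _).const_add _

/-- The partial sums of the coordinate functionals. -/
noncomputable def jamesPartial (u' : ℕ → StrongDual ℝ (JamesSpace b.basis)) (n : ℕ) :
    StrongDual ℝ (JamesSpace b.basis) := ∑ j ∈ Finset.range n, u' j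

theorem SuppressionBound.tendsto_jamesPartial (hK : SuppressionBound b K) (hb : ∀ i, ‖b i‖ = 1)
    (hu' : ∀ i a, u' i (toJames b.basis a) = a i) {S : StrongDual ℝ (JamesSpace b.basis)}
    (hS : ∀ a, S (toJames b.basis a) = coeffSum a) (z : JamesSpace b.basis) :
    Tendsto (fun n => jamesPartial u' n z) atTop (𝓝 (S z)) := by
  have hK0 := hK.pos
  have happ : ∀ n a, jamesPartial u' n (toJames b.basis a) = coeffSum (a.filter (· < n)) := by
    intro n a
    rw [filter_lt_eq_sum, map_sum, jamesPartial, sum_apply]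
    exact Finset.sum_congr rfl fun j _ => by rw [hu', map_smul, coeffSum_single]; simp
  have hnorm : ∀ n, ‖jamesPartial u' n‖ ≤ K * K := by
    intro n
    refine norm_functional_le b.basis _ (by positivity) fun a => ?_
    rw [happ, mul_assoc]
    exact (abs_coeffSum_le hb _).trans (hK.jamesNorm_filter_lt_le a n)
  have hSn : ‖S‖ ≤ 1 := norm_functional_le b.basis S zero_le_one fun a => by
    rw [hS, one_mul]; exact abs_coeffSum_le hb a
  refine Metric.tendsto_atTop.2 fun ε hε => ?_
  set R : ℝ := K * K + 1 with hR
  have hR0 : 0 < R := by positivity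
  obtain ⟨a, ha⟩ := (denseRange_toJames b.basis).exists_dist_lt z (div_pos hε hR0)
  refine ⟨a.support.sup id + 1, fun n hn => ?_⟩
  have heq : jamesPartial u' n (toJames b.basis a) = S (toJames b.basis a) := by
    rw [happ, hS, Finsupp.filter_eq_self_iff _ _ |>.2]
    intro j hj
    exact (Nat.lt_succ_of_le (Finset.le_sup (f := id) (Finsupp.mem_support_iff.2 hj))).trans_le hn
  have h1 : jamesPartial u' n z - S z =
      (jamesPartial u' n - S) (z - toJames b.basis a) := by
    rw [map_sub, sub_apply, sub_apply, heq, sub_self, sub_zero]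
  rw [Real.dist_eq, h1]
  have h2 : ‖jamesPartial u' n - S‖ ≤ R := (norm_sub_le _ _).trans (add_le_add (hnorm n) hSn)
  refine (((jamesPartial u' n - S).le_of_opNorm_le h2 _)).trans_lt ?_
  rw [← dist_eq_norm, mul_comm]
  exact (lt_div_iff₀ hR0).1 ha

theorem tendsto_jamesPartial_jamesUnit (hu' : ∀ i a, u' i (toJames b.basis a) = a i) (n : ℕ) :
    Tendsto (fun m => jamesPartial u' n (jamesUnit b.basis m)) atTop (𝓝 0) := by
  refine tendsto_const_nhds.congr' ?_
  filter_upwards [eventually_ge_atTop n] with m hm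
  rw [jamesPartial, sum_apply, Finset.sum_eq_zero]
  intro j hj
  have : m ≠ j := by have := Finset.mem_range.1 hj; omega
  rw [jamesUnit, hu', Finsupp.single_apply, if_neg this]

end JamesDual

section PropertyW

variable {E : Type*} [NormedAddCommGroup E] [NormedSpace ℝ E]
variable {b : SchauderBasis ℝ E} {K : ℝ}

theorem SuppressionBound.exists_norm_sum_jamesUnit_sub_le (hK : SuppressionBound b K)
    (hb : ∀ i, ‖b i‖ = 1) {p : ℝ} (hp : 0 < p) (hupper : UpperEstimate b p) :
    ∃ C : ℝ, 0 ≤ C ∧ ∀ k : ℕ → ℕ, StrictMono k → ∀ (F : Finset ℕ) (t : ℕ → ℝ),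
      ‖∑ i ∈ F, t i • (jamesUnit b.basis (k (2 * i + 1)) - jamesUnit b.basis (k (2 * i)))‖ ≤
        C * (∑ i ∈ F, |t i| ^ p) ^ (1 / p) := by
  classical
  obtain ⟨C, hC0, hC⟩ := hK.exists_jamesNorm_sum_blocks_le hb hp hupper
  have hK0 := hK.pos
  refine ⟨C * (2 * K), by positivity, fun k hk F t => ?_⟩
  set t' : ℕ → ℝ := fun i => if i ∈ F then t i else 0 with ht'
  set d : ℕ → ℕ →₀ ℝ := fun i => Finsupp.single (k (2 * i + 1)) 1 - Finsupp.single (k (2 * i)) 1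
    with hd
  have hdn : ∀ i, jamesNorm b.basis (d i) ≤ 2 * K := by
    intro i
    rw [← norm_toJames, hd, map_sub]
    refine (norm_sub_le _ _).trans ?_
    rw [norm_toJames, norm_toJames]
    have h1 := hK.jamesNorm_single_le hb (k (2 * i + 1)) 1
    have h2 := hK.jamesNorm_single_le hb (k (2 * i)) 1
    rw [abs_one, mul_one] at h1 h2
    linarith
  set n := F.sup id + 1 with hn
  have hF : F ⊆ Finset.range n := fun i hi =>
    Finset.mem_range.2 (Nat.lt_succ_of_le (Finset.le_sup (f := id) hi))
  have hsum : ∑ i ∈ F, t i • (jamesUnit b.basis (k (2 * i + 1)) - jamesUnit b.basis (k (2 * i))) =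
      toJames b.basis (∑ i ∈ Finset.range n, t' i • d i) := by
    rw [map_sum]
    refine Eq.trans (Finset.sum_congr rfl fun i hi => ?_)
      (Finset.sum_subset hF fun i _ hi => ?_)
    · simp [ht', hi, hd, jamesUnit]
    · simp [ht', hi]
  have hpow : ∑ i ∈ Finset.range n, |t' i| ^ p = ∑ i ∈ F, |t i| ^ p := by
    refine (Eq.trans (Finset.sum_congr rfl fun i hi => ?_)
      (Finset.sum_subset hF fun i _ hi => ?_)).symm
    · simp [ht', hi]
    · simp [ht', hi, hp.ne']
  rw [hsum, norm_toJames, ← hpow, mul_assoc]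
  refine (hC (fun i => k (2 * i)) (fun i => t' i • d i) (fun i j hij => hk (by omega)) ?_ ?_ n).trans
    (mul_le_mul_of_nonneg_left (rpow_sum_rpow_le hp (by positivity)
      (fun i => jamesNorm_nonneg _ _) (fun i => ?_) (fun i => abs_nonneg _) _) hC0)
  · intro i j hj
    have hj' : k (2 * i) = j ∨ k (2 * i + 1) = j := by
      by_contra h
      push Not at h
      exact hj (by simp [hd, h.1, h.2])
    have h1 : k (2 * i) < k (2 * i + 1) := hk (Nat.lt_succ_self _)
    have h2 : k (2 * i + 1) < k (2 * (i + 1)) := hk (by omega)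
    omega
  · intro i
    simp [hd, coeffSum_single]
  · rw [jamesNorm_smul, Real.norm_eq_abs, mul_comm]
    exact mul_le_mul_of_nonneg_right (hdn i) (abs_nonneg _)

theorem norm_sum_lpUnitVector {p : ℝ≥0∞} [Fact (1 ≤ p)] (hp : p ≠ ∞) (F : Finset ℕ) (a : ℕ → ℝ) :
    ‖∑ i ∈ F, a i • lpUnitVector p i‖ = (∑ i ∈ F, |a i| ^ p.toReal) ^ (1 / p.toReal) := by
  have hp0 : 0 < p.toReal := ENNReal.toReal_pos
    (zero_lt_one.trans_le (Fact.out : 1 ≤ p)).ne' hp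
  have h1 : ∑ i ∈ F, a i • lpUnitVector p i = ∑ i ∈ F, lp.single p i (a i) := by
    refine Finset.sum_congr rfl fun i _ => ?_
    rw [lpUnitVector, ← lp.single_smul, smul_eq_mul, mul_one]
  rw [h1]
  have h2 := lp.norm_sum_single (E := fun _ : ℕ => ℝ) hp0 a F
  simp only [Real.norm_eq_abs] at h2
  rw [← h2, ← Real.rpow_mul (norm_nonneg _), mul_one_div_cancel hp0.ne', Real.rpow_one]

theorem SuppressionBound.propertyW_jamesSpace (hK : SuppressionBound b K)
    (hb : ∀ i, ‖b i‖ = 1)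
    (hsub : ∀ n : ℕ → ℕ, StrictMono n → SeqEquivalent (fun i => b (n i)) (fun i => b i))
    (hE : IsReflexiveSpace E) {p : ℝ≥0∞} [Fact (1 ≤ p)] (hp₁ : 1 < p) (hp : p ≠ ∞)
    (hupper : UpperEstimate b p.toReal) (hlp : ¬ Dominates (lpUnitVector p) b.coord) :
    PropertyW (JamesSpace b.basis) := by
  have hp' : 1 < p.toReal := by
    rw [← ENNReal.toReal_one]
    exact (ENNReal.toReal_lt_toReal ENNReal.one_ne_top hp).2 hp₁
  have hp0 := zero_lt_one.trans hp'
  have hK0 := hK.pos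
  intro T
  by_contra hT
  obtain ⟨C, n, k, hC, hn, hk, hdiag⟩ := exists_diagonal_estimate
    (hK.bidualSpannedBy_jamesUnit hb hp' hupper hE) (hK.weaklyCauchy_jamesUnit hb hp' hupper) hT
  obtain ⟨C₁, hC₁, h₁⟩ := hK.exists_norm_sum_jamesUnit_sub_le hb hp0 hupper
  obtain ⟨C₂, hC₂, h₂⟩ := hK.exists_jamesNorm_sum_sub_le hb hsub
  refine hlp (dominates_iff.2 ⟨C * (C₁ * C₂ + K) * K, by positivity, fun F a => ?_⟩)
  rw [norm_sum_lpUnitVector hp]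
  set A := (∑ i ∈ F, |a i| ^ p.toReal) ^ (1 / p.toReal) with hA
  have hA0 : 0 ≤ A := by positivity
  have haA : ∀ i ∈ F, |a i| ≤ A := by
    intro i hi
    have h := Finset.single_le_sum (f := fun i => |a i| ^ p.toReal)
      (fun _ _ => by positivity) hi
    have h' := Real.rpow_le_rpow (by positivity) h (z := 1 / p.toReal) (by positivity)
    rwa [← Real.rpow_mul (abs_nonneg _), mul_one_div_cancel hp0.ne', Real.rpow_one] at h'
  have key := hK.norm_sum_coord_le (F := F) (a := a) (C := C * (C₁ * C₂ + K) * A) (by positivity)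
    fun t => by
      set B := ‖∑ i ∈ F, t i • b i‖ with hB
      have htB : ∀ i ∈ F, |t i| ≤ K * B := fun i hi =>
        hK.abs_le_norm_sum hb (l := id) (Set.injOn_id _) t hi
      refine (hdiag F a t A (K * B) haA htB hA0 (by positivity)).trans ?_
      have e1 := h₁ n hn F a
      have e2 : ‖∑ i ∈ F, t i • (jamesUnit b.basis (k (2 * i)) -
          jamesUnit b.basis (k (2 * i + 1)))‖ ≤ C₂ * B := by
        refine le_trans (le_of_eq ?_) (h₂ k hk F t)
        rw [← norm_toJames, map_sum]
        congr 1
        exact Finset.sum_congr rfl fun i _ => by simp [jamesUnit]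
      calc _ ≤ C * (C₁ * A * (C₂ * B) + A * (K * B)) := by
            gcongr
        _ = C * (C₁ * C₂ + K) * A * B := by ring
  linarith

theorem SuppressionBound.propertyW_dual_jamesSpace (hK : SuppressionBound b K)
    (hb : ∀ i, ‖b i‖ = 1)
    (hsub : ∀ n : ℕ → ℕ, StrictMono n → SeqEquivalent (fun i => b (n i)) (fun i => b i))
    {u' : ℕ → StrongDual ℝ (JamesSpace b.basis)} (hu' : ∀ i a, u' i (toJames b.basis a) = a i)
    (hspan : BidualSpannedBy (jamesPartial u')) (hcau : WeaklyCauchy (jamesPartial u'))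
    (hdom : ¬ Dominates b.coord b.basis) :
    PropertyW (StrongDual ℝ (JamesSpace b.basis)) := by
  have hK0 := hK.pos
  intro T
  by_contra hT
  obtain ⟨C, n, k, hC, hn, hk, hdiag⟩ := exists_diagonal_estimate hspan hcau hT
  obtain ⟨C₁, hC₁, h₁⟩ := hK.exists_abs_sum_intervals_le hb hsub
  have hnorm : ∀ (n : ℕ → ℕ), StrictMono n → ∀ (F : Finset ℕ) (t : ℕ → ℝ),
      ‖∑ i ∈ F, t i • (jamesPartial u' (n (2 * i + 1)) - jamesPartial u' (n (2 * i)))‖ ≤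
        C₁ * ‖∑ i ∈ F, t i • b.coord i‖ := by
    intro n hn F t
    refine norm_functional_le b.basis _ (by positivity) fun a => ?_
    refine le_trans (le_of_eq ?_) (h₁ n hn F t a)
    congr 1
    rw [sum_apply]
    refine Finset.sum_congr rfl fun i _ => ?_
    have hle : n (2 * i) ≤ n (2 * i + 1) := hn.monotone (Nat.le_succ _)
    rw [smul_apply, sub_apply, jamesPartial, jamesPartial, sum_apply, sum_apply,
      ← Finset.sum_Ico_eq_sub _ hle, smul_eq_mul]
    simp only [hu']
  refine hdom (dominates_iff.2 ⟨C * (C₁ * C₁ + 1) * K, by positivity, fun F a => ?_⟩)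
  have hcoef : ∀ t : ℕ → ℝ, ∀ i ∈ F, |t i| ≤ ‖∑ i ∈ F, t i • b.coord i‖ := by
    intro t i hi
    have h1 := (∑ i ∈ F, t i • b.coord i).le_opNorm (b i)
    have h2 : (∑ j ∈ F, t j • b.coord j) (b i) = t i := by
      simp [sum_apply, coord_basis, hi]
    rwa [h2, hb, mul_one, Real.norm_eq_abs] at h1
  set A := ‖∑ i ∈ F, a i • b.coord i‖ with hA
  have key := hK.norm_sum_basis_le (F := F) (a := a) (C := C * (C₁ * C₁ + 1) * A) (by positivity)
    fun t => by
      set B := ‖∑ i ∈ F, t i • b.coord i‖ with hB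
      refine (hdiag F a t A B (hcoef a) (hcoef t) (norm_nonneg _) (norm_nonneg _)).trans ?_
      have e1 := hnorm n hn F a
      have e2 : ‖∑ i ∈ F, t i • (jamesPartial u' (k (2 * i)) -
          jamesPartial u' (k (2 * i + 1)))‖ ≤ C₁ * B := by
        refine le_trans (le_of_eq ?_) (hnorm k hk F t)
        rw [← norm_neg, ← Finset.sum_neg_distrib]
        congr 1
        exact Finset.sum_congr rfl fun i _ => (smul_neg _ _).symm.trans (by rw [neg_sub])
      calc _ ≤ C * (C₁ * A * (C₁ * B) + A * B) := by gcongr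
        _ = C * (C₁ * C₁ + 1) * A * B := by ring
  linarith

end PropertyW

theorem mainTheorem3 {E : Type*} [NormedAddCommGroup E] [NormedSpace ℝ E] [CompleteSpace E]
    (b : SchauderBasis ℝ E) (p : ℝ≥0∞) [Fact (1 ≤ p)] (hp₁ : 1 < p) (hp : p ≠ ∞)
    (hE : IsReflexiveSpace E)
    (hnorm : ∀ i, ‖b i‖ = 1)
    (hsub : IsSubsymmetric b)
    (hupper : UpperEstimate b p.toReal)
    (hdom : ¬ Dominates b.coord b.basis)
    (hlp : ¬ Dominates (lpUnitVector p) b.coord) :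
    PropertyW (JamesSpace b.basis) ∧
      PropertyW (StrongDual ℝ (JamesSpace b.basis)) ∧
      ¬ WeaklySequentiallyComplete (StrongDual ℝ (JamesSpace b.basis)) ∧
      ¬ WeaklySequentiallyComplete (StrongDual ℝ (StrongDual ℝ (JamesSpace b.basis))) := by
  obtain ⟨K, hK⟩ := exists_suppressionBound hsub.1
  have hp' : 1 < p.toReal := by
    rw [← ENNReal.toReal_one]
    exact (ENNReal.toReal_lt_toReal ENNReal.one_ne_top hp).2 hp₁
  obtain ⟨u', hu'⟩ := exists_jamesCoord hK hnorm
  obtain ⟨S, hS⟩ := exists_jamesSum hnorm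
  have hspan := hK.bidualSpannedBy_jamesUnit hnorm hp' hupper hE
  have hcau := hK.weaklyCauchy_jamesUnit hnorm hp' hupper
  have hlim := hK.tendsto_jamesPartial hnorm hu' hS
  have hzero := tendsto_jamesPartial_jamesUnit hu'
  have hone : ∀ m, S (jamesUnit b.basis m) = 1 := fun m => by
    rw [jamesUnit, hS, coeffSum_single]
  exact ⟨hK.propertyW_jamesSpace hnorm hsub.2 hE hp₁ hp hupper hlp,
    hK.propertyW_dual_jamesSpace hnorm hsub.2 hu'
      (bidualSpannedBy_dual_sequence hspan hcau hlim hzero hone)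
      (weaklyCauchy_dual_sequence hspan hcau hlim hzero) hdom,
    not_weaklySequentiallyComplete_dual hspan hcau hlim hzero hone,
    not_weaklySequentiallyComplete_bidual hspan hcau hlim hzero hone⟩
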